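/- For a probability measure $\mu$ on $\mathbb{R}^n$ let $\Lambda^*_\mu(x)=\sup_{\xi\in\mathbb{R}^n}\bigl(\langle x,\xi\rangle-\log\int e^{\langle y,\xi\rangle}\,d\mu(y)\bigr)$ and $\mathbb{E}\Lambda^*_\mu=\int\Lambda^*_\mu\,d\mu$. For $N\in\mathbb{N}$ let $K_N=\mathrm{conv}\{X_1,\dots,X_N\}$, where $X_1,\dots,X_N$ are independent random vectors with law $\mu$, and let $\mathbb{E}\mu(K_N)$ be the expectation of the $\mu$-measure of $K_N$. For $\delta\in(0,1)$ put $$\varrho_1(\mu,\delta)=\sup\{r>0:\ \mathbb{E}\mu(K_N)\le\delta\ \text{for every } N\le e^r\},\qquad \varrho_2(\mu,\delta)=\inf\{r>0:\ \mathbb{E}\mu(K_N)\ge 1-\delta\ \text{for every } N\ge e^r\},$$ and $\varrho(\mu,\delta)=\varrho_2(\mu,\delta)-\varrho_1(\mu,\delta)$. A Borel measure $\lambda$ on $\mathbb{R}$ is log-concave if $\lambda((1-t)A+tB)\ge\lambda(A)^{1-t}\lambda(B)^t$ for all Borel sets $A,B\subset\mathbb{R}$ and all $t\in(0,1)$. Theorem.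 There is an absolute constant $C>0$ such that the following holds. Let $(\lambda_m)_{m\ge1}$ be a sequence of log-concave probability measures on $\mathbb{R}$, none of which is concentrated at a single point, and let $\mu_n=\lambda_1\otimes\cdots\otimes\lambda_n$ for $n\ge1$. Then $0<\mathbb{E}\Lambda^*_{\mu_n}<\infty$ for every $n\ge 1$, and: (i) for every $\varepsilon\in(0,1)$ and every sequence $N=N(n)$ of natural numbers, $\mathbb{E}\mu_n(K_N)\to0$ as $n\to\infty$ if $N\le\exp((1-\varepsilon)\mathbb{E}\Lambda^*_{\mu_n})$ for all large $n$, and $\mathbb{E}\mu_n(K_N)\to1$ as $n\to\infty$ if $N\ge\exp((1+\varepsilon)\mathbb{E}\Lambda^*_{\mu_n})$ for all large $n$; (ii) for every $n\ge1$ and every $\delta\in(0,1)$, the sets that define $\varrho_1(\mu_n,\delta)$ and $\varrho_2(\mu_n,\delta)$ are nonempty, the first one is bounded above, and $$\frac{\varrho(\mu_n,\delta)}{\mathbb{E}\Lambda^*_{\mu_n}}\le C\max\Bigl\{(\delta n)^{-1/2},\frac{\log n}{n}\Bigr\}.$$ -/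

import Mathlib

open MeasureTheory Filter Topology
open scoped ENNReal Pointwise

/-- A Borel measure is log-concave if `μ ((1-t)A + tB) ≥ μ(A)^(1-t) μ(B)^t` for all measurable
`A`, `B` and all `t ∈ (0,1)`.  (The Minkowski combination need not be Borel; `μ` of such a set is
its outer measure, as usual.) -/
def IsLogConcaveMeasure {E : Type*} [AddCommGroup E] [Module ℝ E] [MeasurableSpace E]
    (μ : Measure E) : Prop :=
  ∀ A B : Set E, MeasurableSet A → MeasurableSet B → ∀ t ∈ Set.Ioo (0 : ℝ) 1,
    μ A ^ (1 - t) * μ B ^ t ≤ μ ((1 - t) • A + t • B)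

/-- The cumulant generating function `ξ ↦ log E exp ⟨X, ξ⟩` of a measure on `ℝⁿ`, with value `+∞`
where the exponential moment is infinite. -/
noncomputable def logLaplace {n : ℕ} (μ : Measure (Fin n → ℝ)) (ξ : Fin n → ℝ) : EReal :=
  ENNReal.log (∫⁻ y, ENNReal.ofReal (Real.exp (y ⬝ᵥ ξ)) ∂μ)

/-- The Cramér transform: the Legendre transform of the cumulant generating function, with values
in the extended reals. -/
noncomputable def cramerTransform {n : ℕ} (μ : Measure (Fin n → ℝ)) (x : Fin n → ℝ) : EReal :=
  ⨆ ξ : Fin n → ℝ, ((x ⬝ᵥ ξ : ℝ) : EReal) - logLaplace μ ξ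

/-- The expectation of the Cramér transform of `μ` (nonnegative for a probability measure `μ`)
under `μ`, as an extended nonnegative real. -/
noncomputable def lexpCramer {n : ℕ} (μ : Measure (Fin n → ℝ)) : ℝ≥0∞ :=
  ∫⁻ x, (cramerTransform μ x).toENNReal ∂μ

/-- The expectation of the Cramér transform as a real number (meaningful if it is finite). -/
noncomputable def expCramer {n : ℕ} (μ : Measure (Fin n → ℝ)) : ℝ :=
  (lexpCramer μ).toReal

/-- `E μ(K_N)`, where `K_N` is the convex hull of `N` independent points with law `μ`. -/
noncomputable def expHullMeasure {n : ℕ} (μ : Measure (Fin n → ℝ)) (N : ℕ) : ℝ≥0∞ :=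
  ∫⁻ X : Fin N → (Fin n → ℝ), μ (convexHull ℝ (Set.range X)) ∂(Measure.pi fun _ => μ)

/-- The `r > 0` such that `E μ(K_N) ≤ δ` for every `N ≤ exp r`. -/
def lowerWindowSet {n : ℕ} (μ : Measure (Fin n → ℝ)) (δ : ℝ) : Set ℝ :=
  {r | 0 < r ∧ ∀ N : ℕ, (N : ℝ) ≤ Real.exp r → expHullMeasure μ N ≤ ENNReal.ofReal δ}

/-- The `r > 0` such that `E μ(K_N) ≥ 1 - δ` for every `N ≥ exp r`. -/
def upperWindowSet {n : ℕ} (μ : Measure (Fin n → ℝ)) (δ : ℝ) : Set ℝ :=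
  {r | 0 < r ∧ ∀ N : ℕ, Real.exp r ≤ (N : ℝ) → ENNReal.ofReal (1 - δ) ≤ expHullMeasure μ N}

/-- `ϱ₁(μ, δ)`. -/
noncomputable def rhoLower {n : ℕ} (μ : Measure (Fin n → ℝ)) (δ : ℝ) : ℝ :=
  sSup (lowerWindowSet μ δ)

/-- `ϱ₂(μ, δ)`. -/
noncomputable def rhoUpper {n : ℕ} (μ : Measure (Fin n → ℝ)) (δ : ℝ) : ℝ :=
  sInf (upperWindowSet μ δ)

/-- The threshold window `ϱ(μ, δ) = ϱ₂(μ, δ) - ϱ₁(μ, δ)`. -/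
noncomputable def rhoWindow {n : ℕ} (μ : Measure (Fin n → ℝ)) (δ : ℝ) : ℝ :=
  rhoUpper μ δ - rhoLower μ δ

/-- The product of the first `n` measures of a sequence, as a measure on `ℝⁿ`. -/
noncomputable def prodMeasure (lam : ℕ → Measure ℝ) (n : ℕ) : Measure (Fin n → ℝ) :=
  Measure.pi fun i : Fin n => lam i

/-! ### Brunn–Minkowski on the line -/

/-! Write Λ* for the Cramér transform of the product measure and E for its mean. The threshold sits
at N ≈ exp E because Λ* is concentrated around E and exp(-Λ*(x)) is, up to lower order factors in
the exponent, the least measure of a half-space with x on its boundary.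

Concentration: Λ* is the sum of the one-dimensional transforms of the coordinates
(`cramerTransform_pi`). Chernoff's bound gives each summand the tail 2 exp(-v) under its own law
(`measure_lt_lineCramer_le`), so its second moment is at most 4, whatever the law. Log-concavity and
non-degeneracy bound its mean below by 1/32 (`IsLogConcaveMeasure.le_integral_lineCramer`). Hence
n/32 ≤ E ≤ 3n, and Chebyshev's inequality puts Λ* within √(8n/δ) of E outside a set of measure δ/2.

Few points: a hull containing x must have a vertex in each closed half-space bounded by a hyperplane
through x. A union bound gives probability at most N exp(-Λ*(x)) (`measure_mem_convexHull_le`).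

Many points: if all closed half-spaces at x have measure at least p, the hull misses x with
probability at most (n + 1) / ((N + 1) p) (`measure_notMem_convexHull_le`). The proof adds one more
point and counts which of the N + 1 exchangeable points matter for the distance to x: at most n + 1
do, by Carathéodory. The depth p is bounded below by a converse of Chernoff's bound for laws with a
log-concave tail (`HasLogConcaveTail.reverse_chernoff`), which loses a power θ and a factor 1 - θ; θ
= √n / (1 + √n) makes the loss exp(O(√n)) at the relevant scale. The marginals of the product have
log-concave tails by induction on the dimension, using Prékopa–Leindler in one variable only
(`logConcave_measure_pi_halfspace`).

All errors in the exponent are O(√(n/δ)); dividing by E ≥ n/32 leaves O((δn)^(-1/2)), the first term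
of the maximum alone. -/

theorem volume_add_volume_le_of_isCompact {A B : Set ℝ} (hA : IsCompact A) (hB : IsCompact B)
    (hA' : A.Nonempty) (hB' : B.Nonempty) : volume A + volume B ≤ volume (A + B) := by
  -- The translates A + b and a + B, with a the maximum of A and b the minimum of B, both lie in A +
  -- B and meet only at a + b.
  obtain ⟨a, ha, hmax⟩ := hA.exists_isGreatest hA'
  obtain ⟨b, hb, hmin⟩ := hB.exists_isLeast hB'
  have h1 : volume ((fun x => x + b) '' A) = volume A := by
    simp
  have h2 : volume ((fun x => a + x) '' B) = volume B := by
    simp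
  have hd : AEDisjoint volume ((fun x => x + b) '' A) ((fun x => a + x) '' B) := by
    refine measure_mono_null (t := {a + b}) ?_ (by simp)
    rintro _ ⟨⟨x, hx, rfl⟩, ⟨y, hy, hxy⟩⟩
    have := hmax hx
    have := hmin hy
    simp only [Set.mem_singleton_iff] at *
    linarith
  have hm : NullMeasurableSet ((fun x => a + x) '' B) :=
    (hB.image (by fun_prop)).measurableSet.nullMeasurableSet
  rw [← h1, ← h2, ← measure_union₀ hm hd]
  apply measure_mono
  rintro _ (⟨x, hx, rfl⟩ | ⟨x, hx, rfl⟩)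
  · exact Set.add_mem_add hx hb
  · exact Set.add_mem_add ha hx

theorem volume_add_volume_le {A B : Set ℝ} (hA : MeasurableSet A) (hB : MeasurableSet B)
    (hA' : A.Nonempty) (hB' : B.Nonempty) : volume A + volume B ≤ volume (A + B) := by
  obtain ⟨a, ha⟩ := hA'
  obtain ⟨b, hb⟩ := hB'
  rw [hA.measure_eq_iSup_isCompact, hB.measure_eq_iSup_isCompact]
  simp only [iSup_and']
  refine ENNReal.biSup_add_biSup_le' ⟨∅, by simp⟩ ⟨∅, by simp⟩ fun K hK L hL => ?_
  -- Inserting a and b keeps the compact sets nonempty, as the compact case demands, without leaving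
  -- A and B.
  calc volume K + volume L ≤ volume (insert a K) + volume (insert b L) := by
        gcongr <;> exact Set.subset_insert _ _
    _ ≤ volume (insert a K + insert b L) :=
        volume_add_volume_le_of_isCompact (hK.2.insert a) (hL.2.insert b)
          (Set.insert_nonempty _ _) (Set.insert_nonempty _ _)
    _ ≤ volume (A + B) := by
        gcongr
        · exact Set.insert_subset ha hK.1
        · exact Set.insert_subset hb hL.1

theorem volume_combo_le {A B : Set ℝ} (hA : MeasurableSet A) (hB : MeasurableSet B)
    (hA' : A.Nonempty) (hB' : B.Nonempty) {t : ℝ} (ht0 : 0 < t) (ht1 : t < 1) :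
    ENNReal.ofReal (1 - t) * volume A + ENNReal.ofReal t * volume B
      ≤ volume ((1 - t) • A + t • B) := by
  have h := volume_add_volume_le (hA.const_smul₀ (1 - t)) (hB.const_smul₀ t)
    (hA'.smul_set) (hB'.smul_set)
  simpa [Measure.addHaar_smul, abs_of_pos ht0, abs_of_pos (sub_pos.2 ht1)] using h

theorem ENNReal.geom_mean_le_arith_mean_weighted (a b : ℝ≥0∞) {t : ℝ} (ht0 : 0 < t)
    (ht1 : t < 1) :
    a ^ (1 - t) * b ^ t ≤ ENNReal.ofReal (1 - t) * a + ENNReal.ofReal t * b := by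
  have h1 : 0 < 1 - t := sub_pos.2 ht1
  rcases eq_or_ne a ⊤ with rfl | ha
  · rw [ENNReal.mul_top (by simpa using h1)]; simp
  rcases eq_or_ne b ⊤ with rfl | hb
  · rw [ENNReal.mul_top (by simpa using ht0)]; simp
  lift a to NNReal using ha
  lift b to NNReal using hb
  have h := NNReal.geom_mean_le_arith_mean2_weighted (1 - t).toNNReal t.toNNReal a b
    (by rw [← Real.toNNReal_add h1.le ht0.le]; simp)
  rw [Real.coe_toNNReal _ h1.le, Real.coe_toNNReal _ ht0.le] at h
  rw [← ENNReal.coe_rpow_of_nonneg _ h1.le, ← ENNReal.coe_rpow_of_nonneg _ ht0.le]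
  simp only [ENNReal.ofReal]
  exact_mod_cast h

/-! ### The Prékopa–Leindler inequality -/

/-- With both suprema equal to 1, the superlevel sets of f and g are nonempty at exactly the levels
below 1. Brunn–Minkowski then applies level by level, and the layer-cake formula yields the
arithmetic mean, stronger than the geometric one. -/
theorem prekopa_leindler_of_sup_eq_one {f g h : ℝ → ℝ} (hf : Measurable f) (hg : Measurable g)
    (hh : Measurable h) (hf0 : ∀ x, 0 ≤ f x) (hg0 : ∀ x, 0 ≤ g x) (hh0 : ∀ x, 0 ≤ h x)
    (hf1 : ∀ x, f x ≤ 1) (hg1 : ∀ x, g x ≤ 1) (hfs : ∀ a < 1, ∃ x, a < f x)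
    (hgs : ∀ a < 1, ∃ x, a < g x) {t : ℝ} (ht0 : 0 < t) (ht1 : t < 1)
    (H : ∀ x y, f x ^ (1 - t) * g y ^ t ≤ h ((1 - t) * x + t * y)) :
    ENNReal.ofReal (1 - t) * (∫⁻ x, ENNReal.ofReal (f x)) +
      ENNReal.ofReal t * (∫⁻ x, ENNReal.ofReal (g x)) ≤ ∫⁻ x, ENNReal.ofReal (h x) := by
  rw [lintegral_eq_lintegral_meas_lt _ (ae_of_all _ hf0) hf.aemeasurable,
    lintegral_eq_lintegral_meas_lt _ (ae_of_all _ hg0) hg.aemeasurable,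
    lintegral_eq_lintegral_meas_lt _ (ae_of_all _ hh0) hh.aemeasurable]
  have hmf : Measurable fun a : ℝ => volume {x | a < f x} :=
    Antitone.measurable fun a b hab => measure_mono fun x hx => lt_of_le_of_lt hab hx
  have hmg : Measurable fun a : ℝ => volume {x | a < g x} :=
    Antitone.measurable fun a b hab => measure_mono fun x hx => lt_of_le_of_lt hab hx
  rw [← lintegral_const_mul _ hmf, ← lintegral_const_mul _ hmg,
    ← lintegral_add_left (hmf.const_mul _)]
  refine setLIntegral_mono' measurableSet_Ioi fun a ha => ?_
  rcases lt_or_ge a 1 with ha1 | ha1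
  · refine (volume_combo_le (measurableSet_lt measurable_const hf)
      (measurableSet_lt measurable_const hg) (hfs a ha1) (hgs a ha1) ht0 ht1).trans
      (measure_mono ?_)
    rintro _ ⟨_, ⟨x, hx, rfl⟩, _, ⟨y, hy, rfl⟩, rfl⟩
    refine lt_of_lt_of_le ?_ (H x y)
    calc a = a ^ (1 - t) * a ^ t := by
          rw [← Real.rpow_add ha]; simp
      _ < f x ^ (1 - t) * g y ^ t :=
          mul_lt_mul'' (Real.rpow_lt_rpow (le_of_lt ha) hx (by linarith))
            (Real.rpow_lt_rpow (le_of_lt ha) hy ht0) (Real.rpow_nonneg (le_of_lt ha) _)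
            (Real.rpow_nonneg (le_of_lt ha) _)
  · have e1 : {x | a < f x} = ∅ := by
      ext x; simpa using (hf1 x).trans ha1
    have e2 : {x | a < g x} = ∅ := by
      ext x; simpa using (hg1 x).trans ha1
    simp [e1, e2]

theorem prekopa_leindler_line {f g h : ℝ → ℝ} (hf : Measurable f) (hg : Measurable g)
    (hh : Measurable h) (hf0 : ∀ x, 0 ≤ f x) (hg0 : ∀ x, 0 ≤ g x) (hh0 : ∀ x, 0 ≤ h x)
    (hfb : BddAbove (Set.range f)) (hgb : BddAbove (Set.range g))
    {t : ℝ} (ht0 : 0 < t) (ht1 : t < 1)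
    (H : ∀ x y, f x ^ (1 - t) * g y ^ t ≤ h ((1 - t) * x + t * y)) :
    (∫⁻ x, ENNReal.ofReal (f x)) ^ (1 - t) * (∫⁻ x, ENNReal.ofReal (g x)) ^ t
      ≤ ∫⁻ x, ENNReal.ofReal (h x) := by
  have h1 : 0 < 1 - t := sub_pos.2 ht1
  set M := ⨆ x, f x with hM
  set M' := ⨆ x, g x with hM'
  have hfM : ∀ x, f x ≤ M := fun x => le_ciSup hfb x
  have hgM : ∀ x, g x ≤ M' := fun x => le_ciSup hgb x
  have hM0 : 0 ≤ M := (hf0 0).trans (hfM 0)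
  have hM0' : 0 ≤ M' := (hg0 0).trans (hgM 0)
  rcases hM0.eq_or_lt with hz | hpos
  · have : ∀ x, f x = 0 := fun x => le_antisymm (hz ▸ hfM x) (hf0 x)
    simp [this, ENNReal.zero_rpow_of_pos h1]
  rcases hM0'.eq_or_lt with hz | hpos'
  · have : ∀ x, g x = 0 := fun x => le_antisymm (hz ▸ hgM x) (hg0 x)
    simp [this, ENNReal.zero_rpow_of_pos ht0]
  set K := M ^ (1 - t) * M' ^ t with hK
  have hKpos : 0 < K := by positivity
  have key := prekopa_leindler_of_sup_eq_one (f := fun x => f x / M) (g := fun x => g x / M')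
    (h := fun x => h x / K) (hf.div_const _) (hg.div_const _) (hh.div_const _)
    (fun x => div_nonneg (hf0 x) hM0) (fun x => div_nonneg (hg0 x) hM0')
    (fun x => div_nonneg (hh0 x) hKpos.le)
    (fun x => div_le_one_of_le₀ (hfM x) hM0) (fun x => div_le_one_of_le₀ (hgM x) hM0')
    (fun a ha => by
      obtain ⟨x, hx⟩ := exists_lt_of_lt_ciSup (show a * M < ⨆ x, f x by rw [← hM]; nlinarith)
      exact ⟨x, by rwa [lt_div_iff₀ hpos]⟩)
    (fun a ha => by
      obtain ⟨x, hx⟩ := exists_lt_of_lt_ciSup (show a * M' < ⨆ x, g x by rw [← hM']; nlinarith)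
      exact ⟨x, by rwa [lt_div_iff₀ hpos']⟩) ht0 ht1
    (fun x y => by
      rw [Real.div_rpow (hf0 x) hM0, Real.div_rpow (hg0 y) hM0', div_mul_div_comm]
      exact div_le_div_of_nonneg_right (H x y) hKpos.le)
  have scale : ∀ {φ : ℝ → ℝ} {c : ℝ}, Measurable φ → 0 < c →
      ∫⁻ x, ENNReal.ofReal (φ x) = ENNReal.ofReal c * ∫⁻ x, ENNReal.ofReal (φ x / c) := by
    intro φ c hφ hc
    rw [← lintegral_const_mul _ (hφ.div_const c).ennreal_ofReal]
    refine lintegral_congr fun x => ?_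
    rw [← ENNReal.ofReal_mul hc.le, mul_div_cancel₀ _ hc.ne']
  rw [scale hf hpos, scale hg hpos', scale hh hKpos, ENNReal.mul_rpow_of_nonneg _ _ h1.le,
    ENNReal.mul_rpow_of_nonneg _ _ ht0.le, mul_mul_mul_comm,
    ENNReal.ofReal_rpow_of_pos hpos, ENNReal.ofReal_rpow_of_pos hpos',
    ← ENNReal.ofReal_mul (by positivity)]
  gcongr
  exact (ENNReal.geom_mean_le_arith_mean_weighted _ _ ht0 ht1).trans key

theorem lintegral_Ioi_zero_eq_lintegral_exp (F : ℝ → ℝ≥0∞) :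
    ∫⁻ a in Set.Ioi 0, F a = ∫⁻ s, ENNReal.ofReal (Real.exp s) * F (Real.exp s) := by
  have h := lintegral_image_eq_lintegral_abs_deriv_mul (s := Set.univ) (f := Real.exp)
    (f' := Real.exp) MeasurableSet.univ
    (fun x _ => (Real.hasDerivAt_exp x).hasDerivWithinAt) Real.exp_injective.injOn F
  simpa [Set.image_univ, Real.range_exp] using h

/-- The Prékopa–Leindler inequality for a log-concave probability measure, for functions with
values in `[0, 1]`. -/
theorem IsLogConcaveMeasure.prekopa_leindler {E : Type*} [AddCommGroup E] [Module ℝ E]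
    [MeasurableSpace E] {μ : Measure E} [IsProbabilityMeasure μ] (hμ : IsLogConcaveMeasure μ)
    {f g h : E → ℝ} (hf : Measurable f) (hg : Measurable g) (hh : Measurable h)
    (hf0 : ∀ x, 0 ≤ f x) (hg0 : ∀ x, 0 ≤ g x) (hh0 : ∀ x, 0 ≤ h x)
    (hf1 : ∀ x, f x ≤ 1) (hg1 : ∀ x, g x ≤ 1) {t : ℝ} (ht0 : 0 < t) (ht1 : t < 1)
    (H : ∀ x y, f x ^ (1 - t) * g y ^ t ≤ h ((1 - t) • x + t • y)) :
    (∫⁻ x, ENNReal.ofReal (f x) ∂μ) ^ (1 - t) * (∫⁻ x, ENNReal.ofReal (g x) ∂μ) ^ t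
      ≤ ∫⁻ x, ENNReal.ofReal (h x) ∂μ := by
  have h1 : 0 < 1 - t := sub_pos.2 ht1
  have layer : ∀ {φ : E → ℝ}, Measurable φ → (∀ x, 0 ≤ φ x) →
      ∫⁻ x, ENNReal.ofReal (φ x) ∂μ =
        ∫⁻ s, ENNReal.ofReal (Real.exp s * μ.real {x | Real.exp s < φ x}) := by
    intro φ hφ hφ0
    rw [lintegral_eq_lintegral_meas_lt _ (ae_of_all _ hφ0) hφ.aemeasurable,
      lintegral_Ioi_zero_eq_lintegral_exp]
    refine lintegral_congr fun s => ?_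
    rw [ENNReal.ofReal_mul (Real.exp_pos s).le, ofReal_measureReal]
  have meas : ∀ φ : E → ℝ, Measurable fun s => Real.exp s * μ.real {x | Real.exp s < φ x} :=
    fun φ => Real.measurable_exp.mul <| Antitone.measurable fun a b hab =>
      measureReal_mono fun x hx => lt_of_le_of_lt (Real.exp_le_exp.2 hab) hx
  have nonneg : ∀ (φ : E → ℝ) s, 0 ≤ Real.exp s * μ.real {x | Real.exp s < φ x} :=
    fun φ s => by positivity
  have bdd : ∀ φ : E → ℝ, (∀ x, φ x ≤ 1) →
      BddAbove (Set.range fun s => Real.exp s * μ.real {x | Real.exp s < φ x}) := by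
    intro φ hφ
    refine ⟨1, ?_⟩
    rintro _ ⟨s, rfl⟩
    rcases le_or_gt (Real.exp s) 1 with hs | hs
    · exact mul_le_one₀ hs measureReal_nonneg measureReal_le_one
    · have : {x | Real.exp s < φ x} = ∅ := by
        ext x; simpa using (hφ x).trans hs.le
      simp [this]
  -- The levels are parametrized as exp s, so geometric means of levels become arithmetic means of
  -- s. Log-concavity of μ is then the Prékopa–Leindler hypothesis for the Lebesgue integrals over
  -- s, and μ needs no density.
  rw [layer hf hf0, layer hg hg0, layer hh hh0]
  refine prekopa_leindler_line (meas f) (meas g) (meas h) (nonneg f) (nonneg g) (nonneg h)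
    (bdd f hf1) (bdd g hg1) ht0 ht1 fun a b => ?_
  rw [Real.mul_rpow (Real.exp_pos _).le measureReal_nonneg,
    Real.mul_rpow (Real.exp_pos _).le measureReal_nonneg, mul_mul_mul_comm, ← Real.exp_mul,
    ← Real.exp_mul, ← Real.exp_add, mul_comm a, mul_comm b]
  gcongr
  have hlc := hμ {x | Real.exp a < f x} {x | Real.exp b < g x}
    (measurableSet_lt measurable_const hf) (measurableSet_lt measurable_const hg) t ⟨ht0, ht1⟩
  have hsub : (1 - t) • {x | Real.exp a < f x} + t • {x | Real.exp b < g x} ⊆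
      {x | Real.exp ((1 - t) * a + t * b) < h x} := by
    rintro _ ⟨_, ⟨x, hx, rfl⟩, _, ⟨y, hy, rfl⟩, rfl⟩
    refine lt_of_lt_of_le ?_ (H x y)
    rw [Real.exp_add, mul_comm _ a, mul_comm _ b, Real.exp_mul, Real.exp_mul]
    exact mul_lt_mul'' (Real.rpow_lt_rpow (Real.exp_pos _).le hx h1)
      (Real.rpow_lt_rpow (Real.exp_pos _).le hy ht0) (by positivity) (by positivity)
  have := ENNReal.toReal_mono (measure_ne_top _ _) (hlc.trans (measure_mono hsub))
  rwa [ENNReal.toReal_mul, ← ENNReal.toReal_rpow, ← ENNReal.toReal_rpow] at this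

/-! ### Log-concave tails -/

/-- The function `r ↦ ν [r, ∞)` is log-concave. -/
def HasLogConcaveTail (ν : Measure ℝ) : Prop :=
  ∀ a b t : ℝ, 0 < t → t < 1 →
    ν.real (Set.Ici a) ^ (1 - t) * ν.real (Set.Ici b) ^ t ≤ ν.real (Set.Ici ((1 - t) * a + t * b))

theorem measure_pi_succ_halfspace {n : ℕ} (lam : Fin (n + 1) → Measure ℝ)
    [∀ i, IsProbabilityMeasure (lam i)] (u : Fin (n + 1) → ℝ) (r : ℝ) :
    Measure.pi lam {y | r ≤ y ⬝ᵥ u} =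
      ∫⁻ y₀, Measure.pi (fun i : Fin n => lam i.succ)
        {z | r - y₀ * u 0 ≤ z ⬝ᵥ fun i => u i.succ} ∂lam 0 := by
  have hmp := measurePreserving_piFinSuccAbove lam 0
  set e := MeasurableEquiv.piFinSuccAbove (fun _ : Fin (n + 1) => ℝ) 0
  have hset : {y : Fin (n + 1) → ℝ | r ≤ y ⬝ᵥ u} =
      e ⁻¹' {q : ℝ × (Fin n → ℝ) | r - q.1 * u 0 ≤ q.2 ⬝ᵥ fun i => u i.succ} := by
    ext y
    simp only [Set.mem_ofPred_eq, Set.mem_preimage, dotProduct, Fin.sum_univ_succ, sub_le_iff_le_add']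
    rfl
  have hm : MeasurableSet {q : ℝ × (Fin n → ℝ) | r - q.1 * u 0 ≤ q.2 ⬝ᵥ fun i => u i.succ} := by
    simp only [dotProduct]
    exact measurableSet_le (by fun_prop) (by fun_prop)
  rw [hset, hmp.measure_preimage hm.nullMeasurableSet, Measure.prod_apply hm]
  rfl

/-- Conditioning on the first coordinate turns the half-space into a lower-dimensional one with a
shifted level. The induction hypothesis for these sections is the pointwise hypothesis of
Prékopa–Leindler for the first factor. -/
theorem logConcave_measure_pi_halfspace {n : ℕ} (lam : Fin n → Measure ℝ)
    [hp : ∀ i, IsProbabilityMeasure (lam i)] (hlam : ∀ i, IsLogConcaveMeasure (lam i))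
    (u : Fin n → ℝ) {t : ℝ} (ht0 : 0 < t) (ht1 : t < 1) (a b : ℝ) :
    (Measure.pi lam).real {y | a ≤ y ⬝ᵥ u} ^ (1 - t) * (Measure.pi lam).real {y | b ≤ y ⬝ᵥ u} ^ t
      ≤ (Measure.pi lam).real {y | (1 - t) * a + t * b ≤ y ⬝ᵥ u} := by
  have h1 : 0 < 1 - t := sub_pos.2 ht1
  induction n generalizing a b with
  | zero =>
    have key : ∀ c : ℝ, (Measure.pi lam).real {y | c ≤ y ⬝ᵥ u} = if c ≤ 0 then 1 else 0 := by
      intro c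
      split_ifs with hc <;> simp [hc]
    rw [key, key, key]
    by_cases ha : a ≤ 0
    · by_cases hb : b ≤ 0
      · have : (1 - t) * a + t * b ≤ 0 := by nlinarith
        simp [ha, hb, this]
      · simp only [hb, if_false, Real.zero_rpow ht0.ne', mul_zero]
        split_ifs <;> norm_num
    · simp only [ha, if_false, Real.zero_rpow h1.ne', zero_mul]
      split_ifs <;> norm_num
  | succ n ih =>
    set ν := Measure.pi fun i : Fin n => lam i.succ with hν
    set v : Fin n → ℝ := fun i => u i.succ with hv
    set G : ℝ → ℝ := fun c => ν.real {z | c ≤ z ⬝ᵥ v} with hG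
    have hGanti : Antitone G := fun c d hcd => measureReal_mono fun z hz => le_trans hcd hz
    have hGm : Measurable G := hGanti.measurable
    have hmeas : ∀ c, Measurable fun y : ℝ => G (c - y * u 0) := fun c =>
      hGm.comp (by fun_prop)
    have hTo : ∀ c, Measure.pi lam {y | c ≤ y ⬝ᵥ u} =
        ∫⁻ y, ENNReal.ofReal (G (c - y * u 0)) ∂lam 0 := by
      intro c
      rw [measure_pi_succ_halfspace]
      exact lintegral_congr fun y => (ofReal_measureReal).symm
    have hPL := (hlam 0).prekopa_leindler (hmeas a) (hmeas b) (hmeas ((1 - t) * a + t * b))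
      (fun _ => measureReal_nonneg) (fun _ => measureReal_nonneg) (fun _ => measureReal_nonneg)
      (fun _ => measureReal_le_one) (fun _ => measureReal_le_one) ht0 ht1 (fun x y => by
        have := ih (fun i => lam i.succ) (fun i => hlam i.succ) v (a - x * u 0) (b - y * u 0)
        have e : (1 - t) * a + t * b - ((1 - t) • x + t • y) * u 0 =
            (1 - t) * (a - x * u 0) + t * (b - y * u 0) := by
          simp only [smul_eq_mul]; ring
        rw [e]
        exact this)
    rw [← hTo, ← hTo, ← hTo] at hPL
    have := ENNReal.toReal_mono (measure_ne_top _ _) hPL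
    rwa [ENNReal.toReal_mul, ← ENNReal.toReal_rpow, ← ENNReal.toReal_rpow] at this

theorem IsLogConcaveMeasure.hasLogConcaveTail {ν : Measure ℝ} [IsProbabilityMeasure ν]
    (hν : IsLogConcaveMeasure ν) : HasLogConcaveTail ν := by
  intro a b t ht0 ht1
  have h := hν (Set.Ici a) (Set.Ici b) measurableSet_Ici measurableSet_Ici t ⟨ht0, ht1⟩
  have hsub : (1 - t) • Set.Ici a + t • Set.Ici b ⊆ Set.Ici ((1 - t) * a + t * b) := by
    rintro _ ⟨_, ⟨x, hx, rfl⟩, _, ⟨y, hy, rfl⟩, rfl⟩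
    simp only [Set.mem_Ici, smul_eq_mul] at *
    have := mul_le_mul_of_nonneg_left hx (sub_pos.2 ht1).le
    have := mul_le_mul_of_nonneg_left hy ht0.le
    linarith
  have := ENNReal.toReal_mono (measure_ne_top _ _) (h.trans (measure_mono hsub))
  rwa [ENNReal.toReal_mul, ← ENNReal.toReal_rpow, ← ENNReal.toReal_rpow] at this

/-- A supporting line at x₀ of the concave function r ↦ log ν [r, ∞): -k is the supremum of the
chord slopes to the right of x₀. The point x₁ ensures that there is such a chord. -/
theorem HasLogConcaveTail.exists_supporting {ν : Measure ℝ} [IsProbabilityMeasure ν]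
    (hν : HasLogConcaveTail ν) {x₀ x₁ : ℝ} (hx : x₀ < x₁) (h₁ : 0 < ν.real (Set.Ici x₁)) :
    ∃ k, 0 ≤ k ∧ ∀ y, ν.real (Set.Ici y) ≤ ν.real (Set.Ici x₀) * Real.exp (-k * (y - x₀)) := by
  set G : ℝ → ℝ := fun c => ν.real (Set.Ici c) with hG
  have hanti : Antitone G := fun c d hcd => measureReal_mono (Set.Ici_subset_Ici.2 hcd)
  have hp : 0 < G x₀ := h₁.trans_le (hanti hx.le)
  set S : Set ℝ := {q | ∃ y, x₀ < y ∧ 0 < G y ∧ q = (Real.log (G x₀) - Real.log (G y)) / (y - x₀)}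
    with hS
  have hSne : S.Nonempty := ⟨_, x₁, hx, h₁, rfl⟩
  have hS0 : ∀ q ∈ S, 0 ≤ q := by
    rintro _ ⟨y, hy, hGy, rfl⟩
    exact div_nonneg (sub_nonneg.2 (Real.log_le_log hGy (hanti hy.le))) (sub_pos.2 hy).le
  have hk0 : 0 ≤ sInf S := le_csInf hSne hS0
  refine ⟨sInf S, hk0, fun y => ?_⟩
  change G y ≤ G x₀ * _
  have hGy0 : 0 ≤ G y := measureReal_nonneg
  rcases hGy0.eq_or_lt with hz | hGy
  · rw [← hz]; positivity
  have goal : Real.log (G y) ≤ Real.log (G x₀) + -sInf S * (y - x₀) → 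
      G y ≤ G x₀ * Real.exp (-sInf S * (y - x₀)) := by
    intro h
    rw [← Real.exp_log hGy, ← Real.exp_log hp, ← Real.exp_add]
    exact Real.exp_le_exp.2 h
  apply goal
  rcases lt_trichotomy y x₀ with hy | rfl | hy
  · have : (Real.log (G y) - Real.log (G x₀)) / (x₀ - y) ≤ sInf S := by
      refine le_csInf hSne ?_
      rintro _ ⟨z, hz, hGz, rfl⟩
      have hyz : 0 < z - y := by linarith
      have hA : 0 < x₀ - y := by linarith
      have hB : 0 < z - x₀ := by linarith
      have h := hν y z ((x₀ - y) / (z - y)) (by positivity)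
        (by rw [div_lt_one hyz]; linarith)
      have e : (1 - (x₀ - y) / (z - y)) * y + (x₀ - y) / (z - y) * z = x₀ := by
        field_simp; ring
      rw [e] at h
      have h2 := Real.log_le_log (by positivity) h
      rw [Real.log_mul (by positivity) (by positivity), Real.log_rpow hGy, Real.log_rpow hGz]
        at h2
      have e2 : 1 - (x₀ - y) / (z - y) = (z - x₀) / (z - y) := by field_simp; ring
      rw [e2, div_mul_eq_mul_div, div_mul_eq_mul_div, ← add_div, div_le_iff₀ hyz] at h2
      rw [div_le_div_iff₀ hA hB]
      change (Real.log (G y) - Real.log (G x₀)) * (z - x₀) ≤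
        (Real.log (G x₀) - Real.log (G z)) * (x₀ - y)
      nlinarith [h2]
    rw [div_le_iff₀ (by linarith)] at this
    linarith
  · simp
  · have : sInf S ≤ (Real.log (G x₀) - Real.log (G y)) / (y - x₀) :=
      csInf_le ⟨0, fun q hq => hS0 q hq⟩ ⟨y, hy, hGy, rfl⟩
    rw [le_div_iff₀ (by linarith)] at this
    linarith

theorem lintegral_exp_le_of_tail_le {ν : Measure ℝ} [IsProbabilityMeasure ν] {p k θ x₀ : ℝ}
    (hp : 0 < p) (hk : 0 < k) (hθ0 : 0 < θ) (hθ1 : θ < 1)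
    (h : ∀ y, ν.real (Set.Ici y) ≤ p * Real.exp (-k * (y - x₀))) :
    ∫⁻ y, ENNReal.ofReal (Real.exp (θ * k * (y - x₀))) ∂ν ≤ ENNReal.ofReal (p ^ θ / (1 - θ)) := by
  have ha0 : 0 < p ^ θ := by positivity
  have hθi : -θ⁻¹ < -1 := by
    rw [neg_lt_neg_iff]; exact (one_lt_inv₀ hθ0).2 hθ1
  -- The layer-cake integral is cut at a = p^θ, where the tail bound p a^(-1/θ) reaches the trivial
  -- bound 1. The two pieces add up to p^θ (1 + θ / (1 - θ)).
  rw [lintegral_eq_lintegral_meas_le _ (ae_of_all _ fun y => (Real.exp_pos _).le)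
    (by fun_prop), ← Set.Ioc_union_Ioi_eq_Ioi ha0.le,
    lintegral_union measurableSet_Ioi (Set.Ioc_disjoint_Ioi le_rfl)]
  have b1 : ∫⁻ a in Set.Ioc 0 (p ^ θ), ν {y | a ≤ Real.exp (θ * k * (y - x₀))} ≤
      ENNReal.ofReal (p ^ θ) := by
    calc _ ≤ ∫⁻ a in Set.Ioc 0 (p ^ θ), 1 := lintegral_mono fun a => prob_le_one
      _ = _ := by simp
  have b2 : ∫⁻ a in Set.Ioi (p ^ θ), ν {y | a ≤ Real.exp (θ * k * (y - x₀))} ≤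
      ENNReal.ofReal (∫ a in Set.Ioi (p ^ θ), p * a ^ (-θ⁻¹)) := by
    rw [ofReal_integral_eq_lintegral_ofReal
      ((integrableOn_Ioi_rpow_of_lt hθi ha0).const_mul p)
      ((ae_restrict_iff' measurableSet_Ioi).2 (ae_of_all _ fun a ha => by
        have : 0 < a := ha0.trans ha
        positivity))]
    refine setLIntegral_mono' measurableSet_Ioi fun a ha => ?_
    have ha' : 0 < a := ha0.trans ha
    have hset : {y | a ≤ Real.exp (θ * k * (y - x₀))} = Set.Ici (x₀ + Real.log a / (θ * k)) := by
      ext y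
      simp only [Set.mem_ofPred_eq, Set.mem_Ici]
      rw [← Real.log_le_iff_le_exp ha', ← le_sub_iff_add_le', div_le_iff₀ (by positivity),
        mul_comm (y - x₀)]
    rw [hset, ← ofReal_measureReal]
    refine ENNReal.ofReal_le_ofReal ((h _).trans (le_of_eq ?_))
    rw [Real.rpow_def_of_pos ha']
    congr 2
    field_simp
    ring
  refine (add_le_add b1 b2).trans ?_
  rw [integral_const_mul, integral_Ioi_rpow_of_lt hθi ha0, ← ENNReal.ofReal_add ha0.le]
  · refine ENNReal.ofReal_le_ofReal (le_of_eq ?_)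
    rw [Real.rpow_add ha0, ← Real.rpow_mul hp.le, Real.rpow_one, mul_neg, mul_inv_cancel₀ hθ0.ne',
      Real.rpow_neg_one]
    have : 1 - θ ≠ 0 := by linarith
    have : -θ⁻¹ + 1 ≠ 0 := by linarith
    have e : -θ⁻¹ + 1 = -(1 - θ) / θ := by field_simp; ring
    rw [e]
    field_simp
    ring
  · apply mul_nonneg hp.le
    apply div_nonneg_of_nonpos
    · have : 0 < (p ^ θ) ^ (-θ⁻¹ + 1) := by positivity
      linarith
    · linarith

theorem HasLogConcaveTail.exists_lintegral_exp_le {ν : Measure ℝ} [IsProbabilityMeasure ν]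
    (hν : HasLogConcaveTail ν) {x₀ x₁ θ : ℝ} (hx : x₀ < x₁) (h₁ : 0 < ν.real (Set.Ici x₁))
    (hθ0 : 0 < θ) (hθ1 : θ < 1) :
    ∃ s, 0 ≤ s ∧ ∫⁻ y, ENNReal.ofReal (Real.exp (s * (y - x₀))) ∂ν ≤
      ENNReal.ofReal (ν.real (Set.Ici x₀) ^ θ / (1 - θ)) := by
  obtain ⟨k, hk0, hk⟩ := hν.exists_supporting hx h₁
  have hp : 0 < ν.real (Set.Ici x₀) :=
    h₁.trans_le (measureReal_mono (Set.Ici_subset_Ici.2 hx.le))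
  rcases hk0.eq_or_lt with rfl | hkpos
  -- Slope zero bounds every tail by the one at x₀; letting y → -∞ forces this tail to be 1, and the
  -- moment of order s = 0 suffices.
  · refine ⟨0, le_rfl, ?_⟩
    have hlim : Tendsto (fun y => ν.real (Set.Ici y)) atBot (𝓝 1) := by
      have := (ENNReal.tendsto_toReal (measure_ne_top ν Set.univ)).comp
        (tendsto_measure_Ici_atBot ν)
      rwa [measure_univ, ENNReal.toReal_one] at this
    have hge : 1 ≤ ν.real (Set.Ici x₀) :=
      le_of_tendsto hlim (Eventually.of_forall fun y => by simpa using hk y)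
    have heq : ν.real (Set.Ici x₀) = 1 := le_antisymm measureReal_le_one hge
    rw [heq]
    simp only [zero_mul, Real.exp_zero, ENNReal.ofReal_one, lintegral_const, measure_univ, mul_one,
      Real.one_rpow]
    rw [ENNReal.one_le_ofReal, le_div_iff₀ (by linarith)]
    linarith
  · exact ⟨θ * k, by positivity, lintegral_exp_le_of_tail_le hp hkpos hθ0 hθ1 hk⟩

/-- A converse of Chernoff's bound for laws with a log-concave tail. -/
theorem HasLogConcaveTail.reverse_chernoff {ν : Measure ℝ} [IsProbabilityMeasure ν]
    (hν : HasLogConcaveTail ν) {T θ : ℝ} (hθ0 : 0 < θ) (hθ1 : θ < 1)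
    (h : ∀ s, 0 ≤ s →
      ENNReal.ofReal (Real.exp (-T)) ≤ ∫⁻ y, ENNReal.ofReal (Real.exp (s * y)) ∂ν) :
    Real.exp (-T) * (1 - θ) ≤ ν.real (Set.Ici 0) ^ θ := by
  -- If ν lived below -ε, the moment at s = (|T| + 1) / ε would fall below exp(-T). This supplies
  -- the mass to the right of the base point that the supporting line needs; at 0 itself there may
  -- be none.
  have hpos : ∀ ε, 0 < ε → 0 < ν.real (Set.Ici (-ε)) := by
    intro ε hε
    by_contra hcon
    have hz : ν (Set.Ici (-ε)) = 0 := by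
      rw [← ofReal_measureReal]; exact ENNReal.ofReal_eq_zero.2 (not_lt.1 hcon)
    have hs : 0 ≤ (|T| + 1) / ε := by positivity
    have h2 : ∫⁻ y, ENNReal.ofReal (Real.exp ((|T| + 1) / ε * y)) ∂ν ≤
        ∫⁻ _, ENNReal.ofReal (Real.exp (-(|T| + 1))) ∂ν := by
      refine lintegral_mono_ae ?_
      have : ∀ᵐ y ∂ν, y ∉ Set.Ici (-ε) := measure_eq_zero_iff_ae_notMem.1 hz
      filter_upwards [this] with y hy
      simp only [Set.mem_Ici, not_le] at hy
      refine ENNReal.ofReal_le_ofReal (Real.exp_le_exp.2 ?_)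
      calc (|T| + 1) / ε * y ≤ (|T| + 1) / ε * (-ε) := by gcongr
        _ = _ := by field_simp
    have h3 := (h _ hs).trans h2
    simp only [lintegral_const, measure_univ, mul_one] at h3
    rw [ENNReal.ofReal_le_ofReal_iff (Real.exp_pos _).le, Real.exp_le_exp] at h3
    linarith [le_abs_self T]
  -- The tilt is centred at -ε with a mass point still further right, at -ε/2; ε → 0 is then taken
  -- by continuity from above of the closed half-lines.
  have hε : ∀ ε, 0 < ε → Real.exp (-T) * (1 - θ) ≤ ν.real (Set.Ici (-ε)) ^ θ := by
    intro ε hε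
    obtain ⟨s, hs0, hs⟩ := hν.exists_lintegral_exp_le (x₀ := -ε) (x₁ := -(ε / 2)) (by linarith)
      (hpos _ (by positivity)) hθ0 hθ1
    have h2 : ∫⁻ y, ENNReal.ofReal (Real.exp (s * y)) ∂ν ≤
        ∫⁻ y, ENNReal.ofReal (Real.exp (s * (y - -ε))) ∂ν := by
      refine lintegral_mono fun y => ENNReal.ofReal_le_ofReal (Real.exp_le_exp.2 ?_)
      gcongr
      linarith
    have h3 := (h s hs0).trans (h2.trans hs)
    rw [ENNReal.ofReal_le_ofReal_iff (div_nonneg (by positivity) (by linarith)),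
      le_div_iff₀ (by linarith)] at h3
    exact h3
  have hlim : Tendsto (fun n : ℕ => ν.real (Set.Ici (-(1 / ((n : ℝ) + 1))))) atTop
      (𝓝 (ν.real (Set.Ici 0))) := by
    have hI : ⋂ n : ℕ, Set.Ici (-(1 / ((n : ℝ) + 1))) = Set.Ici 0 := by
      ext y
      simp only [Set.mem_iInter, Set.mem_Ici]
      constructor
      · intro hy
        simpa using le_of_tendsto' (tendsto_one_div_add_atTop_nhds_zero_nat (𝕜 := ℝ)).neg hy
      · intro hy n
        have : 0 < 1 / ((n : ℝ) + 1) := by positivity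
        linarith
    have := tendsto_measure_iInter_atTop (μ := ν) (s := fun n : ℕ =>
      Set.Ici (-(1 / ((n : ℝ) + 1)))) (fun n => measurableSet_Ici.nullMeasurableSet)
      (fun m n hmn => Set.Ici_subset_Ici.2 (by
        rw [neg_le_neg_iff]; gcongr)) ⟨0, measure_ne_top _ _⟩
    rw [hI] at this
    exact (ENNReal.tendsto_toReal (measure_ne_top _ _)).comp this
  exact ge_of_tendsto' (hlim.rpow_const (Or.inr hθ0.le)) fun n => hε _ (by positivity)

/-! ### Random convex hulls and half-space depth -/

theorem convexHull_range_eq_image_stdSimplex {ι E : Type*} [Fintype ι] [AddCommGroup E]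
    [Module ℝ E] (X : ι → E) :
    convexHull ℝ (Set.range X) = (fun w : ι → ℝ => ∑ i, w i • X i) '' stdSimplex ℝ ι := by
  classical
  have h := (Fintype.linearCombination ℝ X).image_convexHull
    (Set.range fun i : ι => (Pi.single i 1 : ι → ℝ))
  rw [convexHull_rangle_single_eq_stdSimplex, ← Set.range_comp] at h
  have e : (⇑(Fintype.linearCombination ℝ X) ∘ fun i : ι => (Pi.single i 1 : ι → ℝ)) = X := by
    funext i
    simp [Fintype.linearCombination_apply_single]
  rw [e] at h
  rw [← h]
  rfl

theorem dotProduct_self_nonneg {n : ℕ} (v : Fin n → ℝ) : 0 ≤ v ⬝ᵥ v :=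
  Finset.sum_nonneg fun i _ => mul_self_nonneg (v i)

/-- The square of the Euclidean distance of two points of `ℝⁿ`. -/
def sqDist {n : ℕ} (x z : Fin n → ℝ) : ℝ := (z - x) ⬝ᵥ (z - x)

theorem sqDist_nonneg {n : ℕ} (x z : Fin n → ℝ) : 0 ≤ sqDist x z :=
  dotProduct_self_nonneg _

theorem continuous_sqDist {n : ℕ} :
    Continuous fun q : (Fin n → ℝ) × (Fin n → ℝ) => sqDist q.1 q.2 := by
  unfold sqDist dotProduct
  simp only [Pi.sub_apply]
  fun_prop

/-- The square of the Euclidean distance of a point to the convex hull of finitely many points. -/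
noncomputable def hullSqDist {n N : ℕ} (x : Fin n → ℝ) (X : Fin N → Fin n → ℝ) : ℝ :=
  sInf (sqDist x '' convexHull ℝ (Set.range X))

theorem isCompact_convexHull_range {n N : ℕ} (X : Fin N → Fin n → ℝ) :
    IsCompact (convexHull ℝ (Set.range X)) :=
  (Set.finite_range X).isCompact_convexHull ℝ

/-- The infimum is taken over weights in the fixed compact simplex, so it depends continuously on
the points. This is the source of all measurability of hull events. -/
theorem continuous_hullSqDist {n N : ℕ} :
    Continuous fun q : (Fin N → Fin n → ℝ) × (Fin n → ℝ) => hullSqDist q.2 q.1 := by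
  have h := (isCompact_stdSimplex ℝ (Fin N)).continuous_sInf
    (f := fun (q : (Fin N → Fin n → ℝ) × (Fin n → ℝ)) (w : Fin N → ℝ) =>
      sqDist q.2 (∑ i, w i • q.1 i))
    (by
      refine continuous_sqDist.comp (Continuous.prodMk ?_ ?_)
      · fun_prop
      · change Continuous fun q : ((Fin N → Fin n → ℝ) × (Fin n → ℝ)) × (Fin N → ℝ) =>
          ∑ i, q.2 i • q.1.1 i
        fun_prop)
  convert! h using 2 with q
  rw [hullSqDist, convexHull_range_eq_image_stdSimplex, Set.image_image]

theorem continuous_hullSqDist_right {n N : ℕ} (x : Fin n → ℝ) :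
    Continuous fun X : Fin N → Fin n → ℝ => hullSqDist x X := by
  have h : Continuous fun X : Fin N → Fin n → ℝ => (X, x) := by fun_prop
  have h' := Continuous.comp continuous_hullSqDist h
  exact h'

theorem exists_hullSqDist_eq {n N : ℕ} (hN : 0 < N) (x : Fin n → ℝ) (X : Fin N → Fin n → ℝ) :
    ∃ z ∈ convexHull ℝ (Set.range X), sqDist x z = hullSqDist x X ∧
      ∀ z' ∈ convexHull ℝ (Set.range X), sqDist x z ≤ sqDist x z' := by
  have hne : (convexHull ℝ (Set.range X)).Nonempty :=
    ⟨X ⟨0, hN⟩, subset_convexHull ℝ _ ⟨_, rfl⟩⟩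
  have hc : ContinuousOn (sqDist x) (convexHull ℝ (Set.range X)) :=
    (continuous_sqDist.comp (Continuous.prodMk continuous_const continuous_id)).continuousOn
  obtain ⟨z, hz, he, hmin⟩ := (isCompact_convexHull_range X).exists_sInf_image_eq_and_le hne hc
  exact ⟨z, hz, he.symm, hmin⟩

theorem hullSqDist_le {n N : ℕ} (x : Fin n → ℝ) (X : Fin N → Fin n → ℝ) {z : Fin n → ℝ}
    (hz : z ∈ convexHull ℝ (Set.range X)) : hullSqDist x X ≤ sqDist x z :=
  csInf_le ⟨0, by rintro _ ⟨y, -, rfl⟩; exact sqDist_nonneg x y⟩ ⟨z, hz, rfl⟩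

/-- The condition on N matters: for N = 0 the hull is empty and `sInf ∅ = 0` would signal
membership. -/
theorem mem_convexHull_range_iff {n N : ℕ} (hN : 0 < N) (x : Fin n → ℝ)
    (X : Fin N → Fin n → ℝ) : x ∈ convexHull ℝ (Set.range X) ↔ hullSqDist x X = 0 := by
  obtain ⟨z, hz, he, hmin⟩ := exists_hullSqDist_eq hN x X
  rw [← he]
  constructor
  · intro hx
    refine le_antisymm ((hmin x hx).trans ?_) (sqDist_nonneg _ _)
    simp [sqDist]
  · intro h0
    have : z - x = 0 := dotProduct_self_eq_zero.1 h0
    rwa [← sub_eq_zero.1 this]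

theorem measurableSet_mem_convexHull {n N : ℕ} :
    MeasurableSet {q : (Fin N → Fin n → ℝ) × (Fin n → ℝ) |
      q.2 ∈ convexHull ℝ (Set.range q.1)} := by
  rcases Nat.eq_zero_or_pos N with rfl | hN
  · simp
  · simp only [mem_convexHull_range_iff hN]
    exact (isClosed_singleton.preimage continuous_hullSqDist).measurableSet

theorem expHullMeasure_eq_lintegral {n : ℕ} (μ : Measure (Fin n → ℝ)) [IsProbabilityMeasure μ]
    (N : ℕ) : expHullMeasure μ N =
      ∫⁻ x, (Measure.pi fun _ : Fin N => μ) {X | x ∈ convexHull ℝ (Set.range X)} ∂μ := by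
  have h1 := Measure.prod_apply (μ := Measure.pi fun _ : Fin N => μ) (ν := μ)
    (measurableSet_mem_convexHull (n := n) (N := N))
  have h2 := Measure.prod_apply_symm (μ := Measure.pi fun _ : Fin N => μ) (ν := μ)
    (measurableSet_mem_convexHull (n := n) (N := N))
  rw [h1] at h2
  exact h2

theorem measurableSet_hull_mem {n N : ℕ} (x : Fin n → ℝ) :
    MeasurableSet {X : Fin N → Fin n → ℝ | x ∈ convexHull ℝ (Set.range X)} :=
  measurable_prodMk_right (y := x) (measurableSet_mem_convexHull (n := n) (N := N))

/-- Only few of the points are needed to realize the distance to the convex hull. -/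
theorem card_hullSqDist_lt_le {n N : ℕ} (x : Fin n → ℝ) (X : Fin (N + 1) → Fin n → ℝ) :
    (Finset.univ.filter fun i : Fin (N + 1) =>
      hullSqDist x X < hullSqDist x fun j => X (i.succAbove j)).card ≤ n + 1 := by
  classical
  obtain ⟨z, hz, he, -⟩ := exists_hullSqDist_eq N.succ_pos x X
  -- Carathéodory: the nearest point z is a combination of an affinely independent set s of at most
  -- n + 1 of the points, and deleting an index whose value is still covered keeps z in the hull.
  rw [convexHull_eq_union] at hz
  simp only [Set.mem_iUnion] at hz
  obtain ⟨s, hs, hind, hzs⟩ := hz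
  have hcard : s.card ≤ n + 1 := by
    have := hind.card_le_finrank_succ
    simp only [Fintype.card_coe] at this
    refine this.trans (Nat.succ_le_succ ?_)
    exact (Submodule.finrank_le _).trans (by simp)
  -- A relevant index carries a point of s that no other index repeats, so X maps the relevant
  -- indices injectively into s.
  have key : ∀ i : Fin (N + 1), hullSqDist x X < hullSqDist x (fun j => X (i.succAbove j)) →
      X i ∈ s ∧ ∀ j, j ≠ i → X j ≠ X i := by
    intro i hi
    have hns : ¬ (s : Set (Fin n → ℝ)) ⊆ Set.range fun j => X (i.succAbove j) := by
      intro hsub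
      have := hullSqDist_le x (fun j => X (i.succAbove j)) (convexHull_mono hsub hzs)
      linarith
    obtain ⟨y, hy, hyn⟩ := Set.not_subset.1 hns
    obtain ⟨k, rfl⟩ := hs hy
    have hki : k = i := by
      by_contra hne
      obtain ⟨j, hj⟩ := Fin.exists_succAbove_eq hne
      exact hyn ⟨j, by simp [hj]⟩
    subst hki
    refine ⟨hy, fun j hj hX => ?_⟩
    obtain ⟨l, hl⟩ := Fin.exists_succAbove_eq hj
    exact hyn ⟨l, by simp only [hl, hX]⟩
  refine le_trans (Finset.card_le_card_of_injOn X ?_ ?_) hcard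
  · intro i hi
    exact (key i (by simpa using hi)).1
  · intro i hi j hj hij
    by_contra hne
    exact (key j (by simpa using hj)).2 i hne hij

/-- A new point in the half-space behind `x` brings the convex hull closer to `x`. -/
theorem exists_halfspace_hullSqDist_lt {n N : ℕ} (hN : 0 < N) (x : Fin n → ℝ)
    (X : Fin N → Fin n → ℝ) (hx : x ∉ convexHull ℝ (Set.range X)) :
    ∃ u : Fin n → ℝ, u ≠ 0 ∧ ∀ y, y ⬝ᵥ u ≤ x ⬝ᵥ u →
      ∀ Y : Fin (N + 1) → Fin n → ℝ, Set.range X ⊆ Set.range Y → y ∈ Set.range Y →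
        hullSqDist x Y < hullSqDist x X := by
  obtain ⟨z, hz, he, -⟩ := exists_hullSqDist_eq hN x X
  have hu : z - x ≠ 0 := fun h => hx (by rwa [← sub_eq_zero.1 h])
  refine ⟨z - x, hu, fun y hy Y hXY hyY => ?_⟩
  set u := z - x with hu'
  have ha : 0 < u ⬝ᵥ u := lt_of_le_of_ne (dotProduct_self_nonneg _)
    fun h => hu (dotProduct_self_eq_zero.1 h.symm)
  set v := y - z with hv
  have hb : v ⬝ᵥ u ≤ -(u ⬝ᵥ u) := by
    have : v = (y - x) - u := by rw [hv, hu']; abel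
    rw [this, sub_dotProduct, sub_dotProduct]
    linarith
  have hc : 0 ≤ v ⬝ᵥ v := dotProduct_self_nonneg _
  -- Moving from z towards y by this fraction makes s|v|² ≤ |u|². With ⟨v, u⟩ ≤ -|u|², the new
  -- squared distance is at most |u|² - s|u|².
  set s := u ⬝ᵥ u / (u ⬝ᵥ u + v ⬝ᵥ v) with hs
  have hden : 0 < u ⬝ᵥ u + v ⬝ᵥ v := by linarith
  have hs0 : 0 < s := by positivity
  have hs1 : s ≤ 1 := by rw [hs, div_le_one hden]; linarith
  have hmem : z + s • v ∈ convexHull ℝ (Set.range Y) := by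
    have h1 := convexHull_mono hXY hz
    have h2 := subset_convexHull ℝ _ hyY
    exact (convex_convexHull ℝ _).add_smul_sub_mem h1 h2 ⟨hs0.le, hs1⟩
  refine (hullSqDist_le x Y hmem).trans_lt ?_
  rw [← he]
  have e1 : sqDist x (z + s • v) = u ⬝ᵥ u + 2 * s * (v ⬝ᵥ u) + s ^ 2 * (v ⬝ᵥ v) := by
    have : z + s • v - x = u + s • v := by rw [hu']; abel
    rw [sqDist, this]
    simp only [add_dotProduct, dotProduct_add, smul_dotProduct, dotProduct_smul, smul_eq_mul]
    rw [dotProduct_comm u v]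
    ring
  have e2 : sqDist x z = u ⬝ᵥ u := rfl
  rw [e1, e2]
  have e3 : s * (v ⬝ᵥ v) ≤ u ⬝ᵥ u := by
    rw [hs, div_mul_eq_mul_div, div_le_iff₀ hden]
    nlinarith
  nlinarith [mul_le_mul_of_nonneg_left e3 hs0.le, mul_le_mul_of_nonneg_left hb hs0.le,
    mul_pos hs0 ha]

theorem measurableSet_hullSqDist_lt {n N : ℕ} (x : Fin n → ℝ) (i : Fin (N + 1)) :
    MeasurableSet {X : Fin (N + 1) → Fin n → ℝ |
      hullSqDist x X < hullSqDist x fun j => X (i.succAbove j)} := by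
  have hr : Continuous fun (X : Fin (N + 1) → Fin n → ℝ) (j : Fin N) => X (i.succAbove j) :=
    continuous_pi fun j => continuous_apply _
  have hr' := Continuous.comp (continuous_hullSqDist_right x) hr
  have h := measurableSet_lt (continuous_hullSqDist_right (N := N + 1) x).measurable hr'.measurable
  exact h

/-- Fubini over the i-th point: when the other N points miss x, their hull determines a half-space
of measure at least p in which the i-th point strictly shortens the distance. -/
theorem mul_measure_notMem_convexHull_le {n N : ℕ} (hN : 0 < N) (μ : Measure (Fin n → ℝ))
    [IsProbabilityMeasure μ] (x : Fin n → ℝ) {p : ℝ≥0∞}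
    (hp : ∀ u : Fin n → ℝ, u ≠ 0 → p ≤ μ {y | y ⬝ᵥ u ≤ x ⬝ᵥ u}) (i : Fin (N + 1)) :
    p * (Measure.pi fun _ : Fin N => μ) {X | x ∉ convexHull ℝ (Set.range X)} ≤
      (Measure.pi fun _ : Fin (N + 1) => μ)
        {X | hullSqDist x X < hullSqDist x fun j => X (i.succAbove j)} := by
  have hVm := measurableSet_hullSqDist_lt (n := n) x i
  have hmp := (measurePreserving_piFinSuccAbove (fun _ : Fin (N + 1) => μ) i).symm
  have hsymm : ∀ (y : Fin n → ℝ) (X : Fin N → Fin n → ℝ),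
      (MeasurableEquiv.piFinSuccAbove (fun _ : Fin (N + 1) => Fin n → ℝ) i).symm (y, X) =
        i.insertNth y X := fun _ _ => rfl
  rw [← hmp.measure_preimage hVm.nullMeasurableSet,
    Measure.prod_apply_symm (hmp.measurable hVm)]
  have hmiss : MeasurableSet {X : Fin N → Fin n → ℝ | x ∉ convexHull ℝ (Set.range X)} :=
    (measurableSet_hull_mem x).compl
  rw [← setLIntegral_const]
  refine (setLIntegral_mono' hmiss fun X hX => ?_).trans (setLIntegral_le_lintegral _ _)
  obtain ⟨u, hu, hlt⟩ := exists_halfspace_hullSqDist_lt hN x X hX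
  refine (hp u hu).trans (measure_mono fun y hy => ?_)
  have hlt' := hlt y hy (i.insertNth y X) (by
    rintro _ ⟨j, rfl⟩
    exact ⟨i.succAbove j, by simp⟩) ⟨i, by simp⟩
  simp only [Set.mem_preimage, Set.mem_ofPred_eq, hsymm, Fin.insertNth_apply_succAbove]
  exact hlt'

/-- If every closed half-space with `x` on its boundary has measure at least `p`, the probability
that the convex hull of `N` random points misses `x` is at most `(n + 1) / ((N + 1) p)`. -/
theorem measure_notMem_convexHull_le {n N : ℕ} (hN : 0 < N) (μ : Measure (Fin n → ℝ))
    [IsProbabilityMeasure μ] (x : Fin n → ℝ) {p : ℝ≥0∞}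
    (hp : ∀ u : Fin n → ℝ, u ≠ 0 → p ≤ μ {y | y ⬝ᵥ u ≤ x ⬝ᵥ u}) :
    ((N + 1 : ℕ) : ℝ≥0∞) * (p * (Measure.pi fun _ : Fin N => μ)
      {X | x ∉ convexHull ℝ (Set.range X)}) ≤ ((n + 1 : ℕ) : ℝ≥0∞) := by
  classical
  set V : Fin (N + 1) → Set (Fin (N + 1) → Fin n → ℝ) := fun i =>
    {X | hullSqDist x X < hullSqDist x fun j => X (i.succAbove j)} with hV
  have hVm : ∀ i, MeasurableSet (V i) := measurableSet_hullSqDist_lt x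
  have hlow : ∀ i, p * (Measure.pi fun _ : Fin N => μ) {X | x ∉ convexHull ℝ (Set.range X)} ≤
      (Measure.pi fun _ : Fin (N + 1) => μ) (V i) := mul_measure_notMem_convexHull_le hN μ x hp
  calc ((N + 1 : ℕ) : ℝ≥0∞) * (p * (Measure.pi fun _ : Fin N => μ)
      {X | x ∉ convexHull ℝ (Set.range X)})
      = ∑ _i : Fin (N + 1), p * (Measure.pi fun _ : Fin N => μ)
        {X | x ∉ convexHull ℝ (Set.range X)} := by simp
    _ ≤ ∑ i : Fin (N + 1), (Measure.pi fun _ : Fin (N + 1) => μ) (V i) :=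
        Finset.sum_le_sum fun i _ => hlow i
    _ = ∫⁻ X, ∑ i : Fin (N + 1), (V i).indicator 1 X ∂(Measure.pi fun _ : Fin (N + 1) => μ) := by
        rw [lintegral_finsetSum _ fun i _ => measurable_one.indicator (hVm i)]
        simp_rw [lintegral_indicator_one (hVm _)]
    _ ≤ ∫⁻ _X, ((n + 1 : ℕ) : ℝ≥0∞) ∂(Measure.pi fun _ : Fin (N + 1) => μ) := by
        refine lintegral_mono fun X => ?_
        have : ∑ i : Fin (N + 1), (V i).indicator (1 : (Fin (N + 1) → Fin n → ℝ) → ℝ≥0∞) X =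
            ((Finset.univ.filter fun i : Fin (N + 1) =>
              hullSqDist x X < hullSqDist x fun j => X (i.succAbove j)).card : ℝ≥0∞) := by
          simp only [Set.indicator_apply, Pi.one_apply, Finset.sum_boole]
          rfl
        rw [this]
        exact Nat.cast_le.2 (by convert! card_hullSqDist_lt_le x X)
    _ = ((n + 1 : ℕ) : ℝ≥0∞) := by simp

/-! ### Nondegenerate log-concave measures have no atoms -/

/-- As t → 0 the factor ν(B)^t tends to 1, because ν(B) > 0. -/
theorem IsLogConcaveMeasure.measure_le_of_combo_subset {ν : Measure ℝ} [IsProbabilityMeasure ν]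
    (hν : IsLogConcaveMeasure ν) {A B D : Set ℝ} (hA : MeasurableSet A) (hB : MeasurableSet B)
    (hB0 : ν B ≠ 0) (h : ∀ t ∈ Set.Ioo (0 : ℝ) 1, (1 - t) • A + t • B ⊆ D) :
    ν.real A ≤ ν.real D := by
  have hb : 0 < ν.real B := ENNReal.toReal_pos hB0 (measure_ne_top _ _)
  have hreal : ∀ t ∈ Set.Ioo (0 : ℝ) 1, ν.real A ^ (1 - t) * ν.real B ^ t ≤ ν.real D := by
    intro t ht
    have := ENNReal.toReal_mono (measure_ne_top _ _)
      ((hν A B hA hB t ht).trans (measure_mono (h t ht)))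
    rwa [ENNReal.toReal_mul, ← ENNReal.toReal_rpow, ← ENNReal.toReal_rpow] at this
  rcases (measureReal_nonneg (μ := ν) (s := A)).eq_or_lt with ha | ha
  · rw [← ha]; exact measureReal_nonneg
  have hc : Tendsto (fun t : ℝ => ν.real A ^ (1 - t) * ν.real B ^ t) (𝓝[>] 0)
      (𝓝 (ν.real A ^ (1 - (0 : ℝ)) * ν.real B ^ (0 : ℝ))) := by
    apply tendsto_nhdsWithin_of_tendsto_nhds
    apply ContinuousAt.tendsto (f := fun t : ℝ => ν.real A ^ (1 - t) * ν.real B ^ t)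
    exact (ContinuousAt.rpow continuousAt_const (by fun_prop) (Or.inl ha.ne')).mul
      (ContinuousAt.rpow continuousAt_const (by fun_prop) (Or.inl hb.ne'))
  simp only [sub_zero, Real.rpow_one, Real.rpow_zero, mul_one] at hc
  refine le_of_tendsto hc ?_
  filter_upwards [Ioo_mem_nhdsGT (zero_lt_one' ℝ)] with t ht using hreal t ht

/-- If x is an atom and there is mass to its right, averaging [x, ∞) with a half-line further right
lands in (x, ∞), so ν [x, ∞) ≤ ν (x, ∞), which is absurd. The same on the left leaves only a point
mass. -/
theorem IsLogConcaveMeasure.nullSingletonClass {ν : Measure ℝ} [IsProbabilityMeasure ν]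
    (hν : IsLogConcaveMeasure ν) (h1 : ∀ x, ν {x} < 1) : NullSingletonClass ν := by
  refine ⟨fun x => ?_⟩
  by_contra hx
  have hpos : 0 < ν.real {x} := ENNReal.toReal_pos hx (measure_ne_top _ _)
  have hr : ν (Set.Ioi x) = 0 := by
    by_contra hne
    have hU : Set.Ioi x = ⋃ n : ℕ, Set.Ici (x + 1 / ((n : ℝ) + 1)) := by
      ext y
      simp only [Set.mem_Ioi, Set.mem_iUnion, Set.mem_Ici]
      constructor
      · intro hy
        obtain ⟨n, hn⟩ := exists_nat_one_div_lt (sub_pos.2 hy)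
        exact ⟨n, by linarith⟩
      · rintro ⟨n, hn⟩
        have : 0 < 1 / ((n : ℝ) + 1) := by positivity
        linarith
    rw [hU, measure_iUnion_null_iff, not_forall] at hne
    obtain ⟨n, hn⟩ := hne
    have hle := hν.measure_le_of_combo_subset (A := Set.Ici x) (D := Set.Ioi x) measurableSet_Ici
      measurableSet_Ici hn (by
        rintro t ⟨ht0, ht1⟩ _ ⟨_, ⟨a, ha, rfl⟩, _, ⟨b, hb, rfl⟩, rfl⟩
        simp only [Set.mem_Ici, Set.mem_Ioi, smul_eq_mul] at *
        have : 0 < 1 / ((n : ℝ) + 1) := by positivity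
        nlinarith)
    have hadd : ν.real (Set.Ici x) = ν.real {x} + ν.real (Set.Ioi x) := by
      rw [← Set.Ioi_insert, Set.insert_eq, measureReal_union (by simp) measurableSet_Ioi]
    linarith
  have hl : ν (Set.Iio x) = 0 := by
    by_contra hne
    have hU : Set.Iio x = ⋃ n : ℕ, Set.Iic (x - 1 / ((n : ℝ) + 1)) := by
      ext y
      simp only [Set.mem_Iio, Set.mem_iUnion, Set.mem_Iic]
      constructor
      · intro hy
        obtain ⟨n, hn⟩ := exists_nat_one_div_lt (sub_pos.2 hy)
        exact ⟨n, by linarith⟩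
      · rintro ⟨n, hn⟩
        have : 0 < 1 / ((n : ℝ) + 1) := by positivity
        linarith
    rw [hU, measure_iUnion_null_iff, not_forall] at hne
    obtain ⟨n, hn⟩ := hne
    have hle := hν.measure_le_of_combo_subset (A := Set.Iic x) (D := Set.Iio x) measurableSet_Iic
      measurableSet_Iic hn (by
        rintro t ⟨ht0, ht1⟩ _ ⟨_, ⟨a, ha, rfl⟩, _, ⟨b, hb, rfl⟩, rfl⟩
        simp only [Set.mem_Iic, Set.mem_Iio, smul_eq_mul] at *
        have : 0 < 1 / ((n : ℝ) + 1) := by positivity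
        nlinarith)
    have hadd : ν.real (Set.Iic x) = ν.real {x} + ν.real (Set.Iio x) := by
      rw [← Set.Iio_insert, Set.insert_eq, measureReal_union (by simp) measurableSet_Iio]
    linarith
  have hc : ν {x}ᶜ = 0 := by
    have : ({x}ᶜ : Set ℝ) = Set.Iio x ∪ Set.Ioi x := by
      ext y; simp
    rw [this]
    exact measure_union_null hl hr
  have : ν {x} = 1 := (prob_compl_eq_zero_iff (by simp)).1 hc
  exact (h1 x).ne this

theorem continuous_measureReal_Ici (ν : Measure ℝ) [IsProbabilityMeasure ν]
    [NullSingletonClass ν] : Continuous fun x => ν.real (Set.Ici x) := by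
  rw [continuous_iff_continuousAt]
  intro b
  have h0 : Tendsto (fun x : ℝ => |x - b|) (𝓝 b) (𝓝 0) := by
    have : Continuous fun x : ℝ => |x - b| := by fun_prop
    simpa using this.tendsto b
  have h1 : Tendsto (fun x : ℝ => ν.real (Set.Icc (b - |x - b|) (b + |x - b|))) (𝓝 b) (𝓝 0) := by
    have := (ENNReal.tendsto_toReal ENNReal.zero_ne_top).comp ((tendsto_measure_Icc ν b).comp h0)
    exact this
  rw [ContinuousAt, tendsto_iff_norm_sub_tendsto_zero]
  refine squeeze_zero (fun _ => norm_nonneg _) (fun x => ?_) h1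
  have s1 : Set.Ici x ⊆ Set.Ici b ∪ Set.Icc (b - |x - b|) (b + |x - b|) := by
    intro y hy
    simp only [Set.mem_Ici, Set.mem_union, Set.mem_Icc] at *
    by_cases hyb : b ≤ y
    · exact Or.inl hyb
    · right
      constructor <;> linarith [neg_abs_le (x - b), abs_nonneg (x - b)]
  have s2 : Set.Ici b ⊆ Set.Ici x ∪ Set.Icc (b - |x - b|) (b + |x - b|) := by
    intro y hy
    simp only [Set.mem_Ici, Set.mem_union, Set.mem_Icc] at *
    by_cases hyb : x ≤ y
    · exact Or.inl hyb
    · right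
      constructor <;> linarith [le_abs_self (x - b), abs_nonneg (x - b)]
  have m1 := (measureReal_mono (μ := ν) s1).trans (measureReal_union_le _ _)
  have m2 := (measureReal_mono (μ := ν) s2).trans (measureReal_union_le _ _)
  rw [Real.norm_eq_abs, abs_sub_le_iff]
  constructor <;> linarith

theorem exists_measureReal_Ici_eq (ν : Measure ℝ) [IsProbabilityMeasure ν]
    [NullSingletonClass ν] {p : ℝ} (hp0 : 0 < p) (hp1 : p < 1) :
    ∃ x, ν.real (Set.Ici x) = p := by
  have hbot : Tendsto (fun y => ν.real (Set.Ici y)) atBot (𝓝 1) := by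
    have := (ENNReal.tendsto_toReal (measure_ne_top ν Set.univ)).comp
      (tendsto_measure_Ici_atBot ν)
    rwa [measure_univ, ENNReal.toReal_one] at this
  have htop : Tendsto (fun y => ν.real (Set.Ici y)) atTop (𝓝 0) := by
    have h := (ENNReal.tendsto_toReal (measure_ne_top ν Set.univ)).comp
      (tendsto_measure_Iic_atTop ν)
    rw [measure_univ, ENNReal.toReal_one] at h
    have h' : Tendsto (fun y => 1 - ν.real (Set.Iic y)) atTop (𝓝 (1 - 1)) := h.const_sub 1
    rw [sub_self] at h'
    refine h'.congr fun y => ?_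
    rw [← probReal_compl_eq_one_sub measurableSet_Iic, Set.compl_Iic]
    exact measureReal_congr Ioi_ae_eq_Ici
  obtain ⟨a, ha⟩ := (hbot.eventually (lt_mem_nhds hp1)).exists
  obtain ⟨b, hb⟩ := (htop.eventually (gt_mem_nhds hp0)).exists
  exact mem_range_of_exists_le_of_exists_ge (continuous_measureReal_Ici ν) ⟨b, hb.le⟩ ⟨a, ha.le⟩

/-! ### The Cramér transform of a measure on the line -/

/-- The quantity `a - log m`, truncated at zero. -/
noncomputable def subLog (a : ℝ) (m : ℝ≥0∞) : ℝ≥0∞ :=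
  ((a : EReal) - ENNReal.log m).toENNReal

theorem subLog_top (a : ℝ) : subLog a ⊤ = 0 := by
  simp [subLog]

theorem subLog_zero (a : ℝ) : subLog a 0 = ⊤ := by
  simp [subLog]

theorem subLog_eq_ofReal (a : ℝ) {m : ℝ≥0∞} (h0 : m ≠ 0) (ht : m ≠ ⊤) :
    subLog a m = ENNReal.ofReal (a - Real.log m.toReal) := by
  rw [subLog, ENNReal.log_pos_real h0 ht, ← EReal.coe_sub]
  exact EReal.toENNReal_of_ne_top (EReal.coe_ne_top _)

theorem subLog_le_ofReal_iff {a v : ℝ} (hv : 0 ≤ v) {m : ℝ≥0∞} :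
    subLog a m ≤ ENNReal.ofReal v ↔ ENNReal.ofReal (Real.exp (a - v)) ≤ m := by
  rcases eq_or_ne m 0 with rfl | h0
  · simp [subLog_zero, Real.exp_pos]
  rcases eq_or_ne m ⊤ with rfl | ht
  · simp [subLog_top]
  have hm : 0 < m.toReal := ENNReal.toReal_pos h0 ht
  rw [subLog_eq_ofReal a h0 ht, ENNReal.ofReal_le_ofReal_iff hv,
    ENNReal.ofReal_le_iff_le_toReal ht, ← Real.le_log_iff_exp_le hm]
  constructor <;> intro h <;> linarith

/-- Only an inequality, because each summand is truncated at zero; `sum_subLog_eq` gives equality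
when no truncation occurs. -/
theorem subLog_sum_prod_le {ι : Type*} (s : Finset ι) (a : ι → ℝ) (m : ι → ℝ≥0∞) :
    subLog (∑ i ∈ s, a i) (∏ i ∈ s, m i) ≤ ∑ i ∈ s, subLog (a i) (m i) := by
  by_cases htop : ∃ i ∈ s, subLog (a i) (m i) = ⊤
  · rw [ENNReal.sum_eq_top.2 htop]; exact le_top
  push Not at htop
  have hv : ∀ i ∈ s, ENNReal.ofReal (Real.exp (a i - (subLog (a i) (m i)).toReal)) ≤ m i :=
    fun i hi => (subLog_le_ofReal_iff ENNReal.toReal_nonneg).1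
      (by rw [ENNReal.ofReal_toReal (htop i hi)])
  have hsum : ∑ i ∈ s, subLog (a i) (m i) =
      ENNReal.ofReal (∑ i ∈ s, (subLog (a i) (m i)).toReal) := by
    rw [ENNReal.ofReal_sum_of_nonneg fun i _ => ENNReal.toReal_nonneg]
    exact Finset.sum_congr rfl fun i hi => (ENNReal.ofReal_toReal (htop i hi)).symm
  rw [hsum, subLog_le_ofReal_iff (Finset.sum_nonneg fun i _ => ENNReal.toReal_nonneg),
    ← Finset.sum_sub_distrib, Real.exp_sum,
    ENNReal.ofReal_prod_of_nonneg fun i _ => (Real.exp_pos _).le]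
  exact Finset.prod_le_prod' hv

theorem sum_subLog_eq {ι : Type*} (s : Finset ι) (a : ι → ℝ) (m : ι → ℝ≥0∞)
    (h0 : ∀ i, m i ≠ 0) (ht : ∀ i, m i ≠ ⊤) (ha : ∀ i, 0 ≤ a i - Real.log (m i).toReal) :
    ∑ i ∈ s, subLog (a i) (m i) = subLog (∑ i ∈ s, a i) (∏ i ∈ s, m i) := by
  rw [subLog_eq_ofReal _ (Finset.prod_ne_zero_iff.2 fun i _ => h0 i)
    (ENNReal.prod_ne_top fun i _ => ht i), ENNReal.toReal_prod,
    Real.log_prod fun i _ => (ENNReal.toReal_pos (h0 i) (ht i)).ne', ← Finset.sum_sub_distrib,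
    ENNReal.ofReal_sum_of_nonneg fun i _ => ha i]
  exact Finset.sum_congr rfl fun i _ => subLog_eq_ofReal _ (h0 i) (ht i)

/-- The exponential moments of a measure on the line. -/
noncomputable def lineMGF (ν : Measure ℝ) (ξ : ℝ) : ℝ≥0∞ :=
  ∫⁻ y, ENNReal.ofReal (Real.exp (y * ξ)) ∂ν

theorem lineMGF_ne_zero (ν : Measure ℝ) [IsProbabilityMeasure ν] (ξ : ℝ) : lineMGF ν ξ ≠ 0 := by
  rw [lineMGF, Ne, lintegral_eq_zero_iff (by fun_prop)]
  intro h
  obtain ⟨y, hy⟩ := h.exists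
  simp only [Pi.zero_apply, ENNReal.ofReal_eq_zero] at hy
  exact absurd hy (not_le.2 (Real.exp_pos _))

theorem lineMGF_zero (ν : Measure ℝ) [IsProbabilityMeasure ν] : lineMGF ν 0 = 1 := by
  simp [lineMGF]

/-- The Cramér transform of a measure on the line. -/
noncomputable def lineCramer (ν : Measure ℝ) (x : ℝ) : ℝ≥0∞ :=
  ⨆ ξ : ℝ, subLog (x * ξ) (lineMGF ν ξ)

theorem measurable_lineCramer (ν : Measure ℝ) : Measurable (lineCramer ν) := by
  refine LowerSemicontinuous.measurable (lowerSemicontinuous_iSup fun ξ => ?_)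
  refine Continuous.lowerSemicontinuous ?_
  rcases eq_or_ne (lineMGF ν ξ) 0 with h0 | h0
  · simp only [h0, subLog_zero]; exact continuous_const
  rcases eq_or_ne (lineMGF ν ξ) ⊤ with ht | ht
  · simp only [ht, subLog_top]; exact continuous_const
  simp only [subLog_eq_ofReal _ h0 ht]
  exact ENNReal.continuous_ofReal.comp (by fun_prop)

theorem cramerTransform_toENNReal {n : ℕ} (μ : Measure (Fin n → ℝ)) (x : Fin n → ℝ) :
    (cramerTransform μ x).toENNReal =
      ⨆ ξ : Fin n → ℝ, subLog (x ⬝ᵥ ξ) (∫⁻ y, ENNReal.ofReal (Real.exp (y ⬝ᵥ ξ)) ∂μ) :=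
  Monotone.map_iSup_of_continuousAt EReal.continuous_toENNReal.continuousAt
    (fun _ _ h => EReal.toENNReal_le_toENNReal h) (by simp)

theorem lintegral_pi_exp {n : ℕ} (lam : Fin n → Measure ℝ) [∀ i, IsProbabilityMeasure (lam i)]
    (ξ : Fin n → ℝ) :
    ∫⁻ y, ENNReal.ofReal (Real.exp (y ⬝ᵥ ξ)) ∂(Measure.pi lam) = ∏ i, lineMGF (lam i) (ξ i) := by
  have hind := ProbabilityTheory.iIndepFun_pi (μ := lam)
    (X := fun i (y : ℝ) => ENNReal.ofReal (Real.exp (y * ξ i))) (fun i => by fun_prop)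
  have h := ProbabilityTheory.lintegral_prod_eq_prod_lintegral_of_indepFun Finset.univ _ hind
    (fun i => by fun_prop)
  have e : ∀ i, ∫⁻ y : Fin n → ℝ, ENNReal.ofReal (Real.exp (y i * ξ i)) ∂(Measure.pi lam) =
      lineMGF (lam i) (ξ i) := fun i =>
    (measurePreserving_eval lam i).lintegral_comp
      (f := fun y => ENNReal.ofReal (Real.exp (y * ξ i))) (by fun_prop)
  simp_rw [e] at h
  rw [← h]
  refine lintegral_congr fun y => ?_
  rw [dotProduct, Real.exp_sum, ENNReal.ofReal_prod_of_nonneg fun i _ => (Real.exp_pos _).le]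

/-- The Cramér transform of a product measure is the sum of those of the factors. -/
theorem cramerTransform_pi {n : ℕ} (lam : Fin n → Measure ℝ) [∀ i, IsProbabilityMeasure (lam i)]
    (x : Fin n → ℝ) :
    (cramerTransform (Measure.pi lam) x).toENNReal = ∑ i, lineCramer (lam i) (x i) := by
  classical
  rw [cramerTransform_toENNReal]
  simp_rw [lintegral_pi_exp]
  apply le_antisymm
  · refine iSup_le fun ξ => (subLog_sum_prod_le _ _ _).trans (Finset.sum_le_sum fun i _ => ?_)
    exact le_iSup (fun η : ℝ => subLog (x i * η) (lineMGF (lam i) η)) (ξ i)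
  · have e : ∀ i, lineCramer (lam i) (x i) =
        ⨆ ξ : Fin n → ℝ, subLog (x i * ξ i) (lineMGF (lam i) (ξ i)) := fun i =>
      ((Function.surjective_eval (β := fun _ : Fin n => ℝ) i).iSup_comp
        (fun η : ℝ => subLog (x i * η) (lineMGF (lam i) η))).symm
    simp_rw [e]
    rw [ENNReal.finsetSum_iSup]
    · refine iSup_le fun ξ => ?_
      -- Coordinates with a truncated or zero contribution are reset to 0, where the moment is 1.
      -- Then no term is negative or infinite and the sum of truncations equals the truncation of
      -- the sum.
      set ξ' : Fin n → ℝ := fun i =>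
        if subLog (x i * ξ i) (lineMGF (lam i) (ξ i)) = 0 then 0 else ξ i with hξ'
      refine le_trans ?_ (le_iSup _ ξ')
      have hcase : ∀ i, subLog (x i * ξ i) (lineMGF (lam i) (ξ i)) ≤
            subLog (x i * ξ' i) (lineMGF (lam i) (ξ' i)) ∧ lineMGF (lam i) (ξ' i) ≠ ⊤ ∧
          0 ≤ x i * ξ' i - Real.log (lineMGF (lam i) (ξ' i)).toReal := by
        intro i
        by_cases hz : subLog (x i * ξ i) (lineMGF (lam i) (ξ i)) = 0
        · have : ξ' i = 0 := by simp [hξ', hz]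
          rw [this, lineMGF_zero, hz]
          simp
        · have : ξ' i = ξ i := by simp [hξ', hz]
          have ht : lineMGF (lam i) (ξ i) ≠ ⊤ := fun ht => hz (by rw [ht, subLog_top])
          rw [this]
          refine ⟨le_rfl, ht, ?_⟩
          rw [subLog_eq_ofReal _ (lineMGF_ne_zero _ _) ht, ENNReal.ofReal_eq_zero, not_le] at hz
          exact hz.le
      refine (Finset.sum_le_sum fun i _ => (hcase i).1).trans (le_of_eq ?_)
      exact sum_subLog_eq Finset.univ (fun i => x i * ξ' i) (fun i => lineMGF (lam i) (ξ' i))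
        (fun i => lineMGF_ne_zero _ _) (fun i => (hcase i).2.1) (fun i => (hcase i).2.2)
    -- Directedness, needed to exchange sum and supremum: choose the better of ξ and η in each
    -- coordinate.
    · intro ξ η
      refine ⟨fun i => if subLog (x i * ξ i) (lineMGF (lam i) (ξ i)) ≤
        subLog (x i * η i) (lineMGF (lam i) (η i)) then η i else ξ i, fun i => ?_⟩
      dsimp only
      split_ifs with h
      · exact ⟨h, le_rfl⟩
      · exact ⟨le_rfl, (not_le.1 h).le⟩

/-! ### Moments of the Cramér transform -/

/-- A compact subset with least element a lies in [a, ∞), whose measure is at most q by membership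
of a. Inner regularity finishes; atoms do no harm. -/
theorem measure_measure_Ici_le (ν : Measure ℝ) [IsProbabilityMeasure ν] (q : ℝ≥0∞) :
    ν {x | ν (Set.Ici x) ≤ q} ≤ q := by
  have hm : MeasurableSet {x | ν (Set.Ici x) ≤ q} :=
    measurableSet_le (Antitone.measurable fun a b hab =>
      measure_mono (Set.Ici_subset_Ici.2 hab)) measurable_const
  rw [hm.measure_eq_iSup_isCompact]
  refine iSup₂_le fun K hK => iSup_le fun hKc => ?_
  rcases K.eq_empty_or_nonempty with rfl | hne
  · simp
  obtain ⟨a, ha, hmin⟩ := hKc.exists_isLeast hne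
  exact (measure_mono fun y hy => hmin hy).trans (hK ha)

theorem measure_measure_Iic_le (ν : Measure ℝ) [IsProbabilityMeasure ν] (q : ℝ≥0∞) :
    ν {x | ν (Set.Iic x) ≤ q} ≤ q := by
  have hm : MeasurableSet {x | ν (Set.Iic x) ≤ q} :=
    measurableSet_le (Monotone.measurable fun a b hab =>
      measure_mono (Set.Iic_subset_Iic.2 hab)) measurable_const
  rw [hm.measure_eq_iSup_isCompact]
  refine iSup₂_le fun K hK => iSup_le fun hKc => ?_
  rcases K.eq_empty_or_nonempty with rfl | hne
  · simp
  obtain ⟨a, ha, hmax⟩ := hKc.exists_isGreatest hne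
  exact (measure_mono fun y hy => hmax hy).trans (hK ha)

/-- Chernoff's bound. -/
theorem measure_le_of_lintegral_exp_lt {Ω : Type*} [MeasurableSpace Ω] {μ : Measure Ω}
    {f : Ω → ℝ} (hf : Measurable f) {a v : ℝ}
    (h : ∫⁻ y, ENNReal.ofReal (Real.exp (f y)) ∂μ < ENNReal.ofReal (Real.exp (a - v))) :
    μ {y | a ≤ f y} ≤ ENNReal.ofReal (Real.exp (-v)) := by
  have hmk := mul_meas_ge_le_lintegral (μ := μ)
    (hf.exp.ennreal_ofReal) (ENNReal.ofReal (Real.exp a))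
  have hset : {y | ENNReal.ofReal (Real.exp a) ≤ ENNReal.ofReal (Real.exp (f y))} =
      {y | a ≤ f y} := by
    ext y
    simp [ENNReal.ofReal_le_ofReal_iff (Real.exp_pos _).le]
  rw [hset] at hmk
  have h2 := hmk.trans h.le
  rw [sub_eq_add_neg, Real.exp_add, ENNReal.ofReal_mul (Real.exp_pos _).le] at h2
  exact (ENNReal.mul_le_mul_iff_right (by simp [Real.exp_pos]) ENNReal.ofReal_ne_top).1 h2

/-- A dual point ξ witnessing a value above v bounds, by Chernoff, the right tail at x if ξ ≥ 0 and
the left tail if ξ ≤ 0 by exp(-v). Points with so small a tail have measure at most exp(-v) on each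
side. -/
theorem measure_lt_lineCramer_le (ν : Measure ℝ) [IsProbabilityMeasure ν] {v : ℝ} (hv : 0 ≤ v) :
    ν {x | ENNReal.ofReal v < lineCramer ν x} ≤ ENNReal.ofReal (2 * Real.exp (-v)) := by
  have hsub : {x | ENNReal.ofReal v < lineCramer ν x} ⊆
      {x | ν (Set.Ici x) ≤ ENNReal.ofReal (Real.exp (-v))} ∪
      {x | ν (Set.Iic x) ≤ ENNReal.ofReal (Real.exp (-v))} := by
    intro x hx
    obtain ⟨ξ, hξ⟩ := lt_iSup_iff.1 (show ENNReal.ofReal v < ⨆ ξ : ℝ, _ from hx)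
    have hlt : lineMGF ν ξ < ENNReal.ofReal (Real.exp (x * ξ - v)) := by
      rw [← not_le, ← subLog_le_ofReal_iff hv, not_le]; exact hξ
    have hM := measure_le_of_lintegral_exp_lt (by fun_prop) hlt
    rcases le_total 0 ξ with h0 | h0
    · exact Or.inl ((measure_mono fun y hy =>
        mul_le_mul_of_nonneg_right (show x ≤ y from hy) h0).trans hM)
    · exact Or.inr ((measure_mono fun y hy =>
        mul_le_mul_of_nonpos_right (show y ≤ x from hy) h0).trans hM)
  refine (measure_mono hsub).trans ((measure_union_le _ _).trans ?_)
  rw [two_mul, ENNReal.ofReal_add (Real.exp_pos _).le (Real.exp_pos _).le]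
  exact add_le_add (measure_measure_Ici_le ν _) (measure_measure_Iic_le ν _)

theorem ae_lineCramer_ne_top (ν : Measure ℝ) [IsProbabilityMeasure ν] :
    ∀ᵐ x ∂ν, lineCramer ν x ≠ ⊤ := by
  rw [ae_iff]
  have hlim : Tendsto (fun n : ℕ => ENNReal.ofReal (2 * Real.exp (-(n : ℝ)))) atTop (𝓝 0) := by
    have h : Tendsto (fun n : ℕ => 2 * Real.exp (-(n : ℝ))) atTop (𝓝 (2 * 0)) :=
      (Real.tendsto_exp_neg_atTop_nhds_zero.comp tendsto_natCast_atTop_atTop).const_mul 2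
    rw [mul_zero] at h
    have h' := (ENNReal.continuous_ofReal.tendsto _).comp h
    rwa [ENNReal.ofReal_zero] at h'
  refine le_antisymm (ge_of_tendsto' hlim fun n => ?_) zero_le
  refine (measure_mono fun x hx => ?_).trans (measure_lt_lineCramer_le ν n.cast_nonneg)
  simp only [Set.mem_ofPred_eq, not_not] at hx
  simp only [Set.mem_ofPred_eq, hx]
  exact ENNReal.ofReal_lt_top

theorem lintegral_lineCramer_sq_le (ν : Measure ℝ) [IsProbabilityMeasure ν] :
    ∫⁻ x, ENNReal.ofReal ((lineCramer ν x).toReal ^ (2 : ℝ)) ∂ν ≤ 4 := by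
  rw [lintegral_rpow_eq_lintegral_meas_lt_mul ν (ae_of_all _ fun x => ENNReal.toReal_nonneg)
    (measurable_lineCramer ν).ennreal_toReal.aemeasurable two_pos]
  have hint : IntegrableOn (fun t : ℝ => 2 * (Real.exp (-t) * t ^ ((2 : ℝ) - 1))) (Set.Ioi 0) :=
    (Real.GammaIntegral_convergent two_pos).const_mul 2
  have hb : ∫⁻ t in Set.Ioi 0, ν {x | t < (lineCramer ν x).toReal} *
      ENNReal.ofReal (t ^ ((2 : ℝ) - 1)) ≤ ENNReal.ofReal 2 := by
    calc _ ≤ ∫⁻ t in Set.Ioi 0, ENNReal.ofReal (2 * (Real.exp (-t) * t ^ ((2 : ℝ) - 1))) := by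
          refine setLIntegral_mono' measurableSet_Ioi fun t ht => ?_
          rw [← mul_assoc, ENNReal.ofReal_mul (by positivity)]
          gcongr
          refine (measure_mono fun x hx => ?_).trans (measure_lt_lineCramer_le ν (le_of_lt ht))
          have hx' : t < (lineCramer ν x).toReal := hx
          have hne : lineCramer ν x ≠ ⊤ := fun h => by
            rw [h, ENNReal.toReal_top] at hx'
            exact lt_asymm hx' ht
          exact (ENNReal.ofReal_lt_iff_lt_toReal (le_of_lt ht) hne).2 hx'
      _ = ENNReal.ofReal (∫ t in Set.Ioi 0, 2 * (Real.exp (-t) * t ^ ((2 : ℝ) - 1))) := by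
          refine (ofReal_integral_eq_lintegral_ofReal hint ?_).symm
          refine (ae_restrict_iff' measurableSet_Ioi).2 (ae_of_all _ fun t ht => ?_)
          have : 0 < t := ht
          simp only [Pi.zero_apply]
          positivity
      _ = ENNReal.ofReal 2 := by
          rw [integral_const_mul, ← Real.Gamma_eq_integral two_pos, Real.Gamma_two, mul_one]
  calc _ ≤ ENNReal.ofReal 2 * ENNReal.ofReal 2 := by gcongr
    _ = 4 := by rw [← ENNReal.ofReal_mul two_pos.le]; norm_num

theorem memLp_lineCramer (ν : Measure ℝ) [IsProbabilityMeasure ν] :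
    MemLp (fun x => (lineCramer ν x).toReal) 2 ν := by
  rw [memLp_two_iff_integrable_sq
    (measurable_lineCramer ν).ennreal_toReal.aestronglyMeasurable]
  refine ⟨((measurable_lineCramer ν).ennreal_toReal.pow_const 2).aestronglyMeasurable, ?_⟩
  rw [hasFiniteIntegral_iff_ofReal (ae_of_all _ fun x => sq_nonneg _)]
  have := lintegral_lineCramer_sq_le ν
  simp only [Real.rpow_two] at this
  exact this.trans_lt (by simp)

theorem integral_lineCramer_sq_le (ν : Measure ℝ) [IsProbabilityMeasure ν] :
    ∫ x, (lineCramer ν x).toReal ^ 2 ∂ν ≤ 4 := by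
  rw [integral_eq_lintegral_of_nonneg_ae (ae_of_all _ fun x => sq_nonneg _)
    ((measurable_lineCramer ν).ennreal_toReal.pow_const 2).aestronglyMeasurable]
  have := lintegral_lineCramer_sq_le ν
  simp only [Real.rpow_two] at this
  simpa using ENNReal.toReal_mono (by simp) this

theorem variance_lineCramer_le (ν : Measure ℝ) [IsProbabilityMeasure ν] :
    ProbabilityTheory.variance (fun x => (lineCramer ν x).toReal) ν ≤ 4 :=
  (ProbabilityTheory.variance_le_expectation_sq
    (measurable_lineCramer ν).ennreal_toReal.aestronglyMeasurable).trans
    (integral_lineCramer_sq_le ν)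

theorem integral_lineCramer_le (ν : Measure ℝ) [IsProbabilityMeasure ν] :
    ∫ x, (lineCramer ν x).toReal ∂ν ≤ 3 := by
  have hint := (memLp_lineCramer ν).integrable one_le_two
  have hsq := (memLp_lineCramer ν).integrable_sq
  have h4 := integral_lineCramer_sq_le ν
  have : ∫ x, (lineCramer ν x).toReal ∂ν ≤ ∫ x, (1 + (lineCramer ν x).toReal ^ 2) / 2 ∂ν :=
    integral_mono hint (((integrable_const _).add hsq).div_const 2) fun x => by
      dsimp only
      nlinarith [sq_nonneg ((lineCramer ν x).toReal - 1)]
  rw [integral_div, integral_add (integrable_const _) hsq] at this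
  simp at this
  linarith

theorem IsLogConcaveMeasure.le_integral_lineCramer {ν : Measure ℝ} [IsProbabilityMeasure ν]
    (hν : IsLogConcaveMeasure ν) (h1 : ∀ x, ν {x} < 1) :
    1 / 32 ≤ ∫ x, (lineCramer ν x).toReal ∂ν := by
  have := hν.nullSingletonClass h1
  -- With tail 1/16 and θ = 1/2 the tilted moment is at most 1/2 ≤ exp(-1/2), so the transform is at
  -- least 1/2 on [x₀, ∞), a set of measure 1/16. The point x₁ only certifies mass beyond x₀.
  obtain ⟨x₀, hx₀⟩ := exists_measureReal_Ici_eq ν (p := 1 / 16) (by norm_num) (by norm_num)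
  obtain ⟨x₁, hx₁⟩ := exists_measureReal_Ici_eq ν (p := 1 / 32) (by norm_num) (by norm_num)
  have hx : x₀ < x₁ := by
    by_contra hcon
    have := measureReal_mono (μ := ν) (Set.Ici_subset_Ici.2 (not_lt.1 hcon))
    rw [hx₀, hx₁] at this
    norm_num at this
  obtain ⟨s, hs0, hs⟩ := hν.hasLogConcaveTail.exists_lintegral_exp_le (θ := 1 / 2) hx
    (by rw [hx₁]; norm_num) (by norm_num) (by norm_num)
  have hval : (1 / 16 : ℝ) ^ (1 / 2 : ℝ) / (1 - 1 / 2) = 1 / 2 := by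
    rw [← Real.sqrt_eq_rpow, show (1 / 16 : ℝ) = (1 / 4) ^ 2 by norm_num,
      Real.sqrt_sq (by norm_num)]
    norm_num
  rw [hx₀, hval] at hs
  have hhalf : (1 : ℝ) / 2 ≤ Real.exp (-(1 / 2)) := by
    have := Real.add_one_le_exp (-(1 / 2 : ℝ))
    linarith
  have hlow : ∀ y ∈ Set.Ici x₀, ENNReal.ofReal (1 / 2) ≤ lineCramer ν y := by
    intro y hy
    by_contra hcon
    have hle : subLog (y * s) (lineMGF ν s) < ENNReal.ofReal (1 / 2) :=
      lt_of_le_of_lt (le_iSup (fun ξ : ℝ => subLog (y * ξ) (lineMGF ν ξ)) s) (not_le.1 hcon)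
    have hM : lineMGF ν s ≤ ENNReal.ofReal (Real.exp (x₀ * s - 1 / 2)) := by
      have e : lineMGF ν s = ENNReal.ofReal (Real.exp (x₀ * s)) *
          ∫⁻ y, ENNReal.ofReal (Real.exp (s * (y - x₀))) ∂ν := by
        rw [lineMGF, ← lintegral_const_mul _ (by fun_prop)]
        refine lintegral_congr fun y => ?_
        rw [← ENNReal.ofReal_mul (Real.exp_pos _).le, ← Real.exp_add]
        congr 2
        ring
      rw [e, sub_eq_add_neg, Real.exp_add, ENNReal.ofReal_mul (Real.exp_pos _).le]
      gcongr
      exact hs.trans (ENNReal.ofReal_le_ofReal hhalf)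
    have hM0 := lineMGF_ne_zero ν s
    have hMt : lineMGF ν s ≠ ⊤ := ne_top_of_le_ne_top ENNReal.ofReal_ne_top hM
    rw [subLog_eq_ofReal _ hM0 hMt, ENNReal.ofReal_lt_ofReal_iff (by norm_num)] at hle
    have h2 : Real.log (lineMGF ν s).toReal ≤ x₀ * s - 1 / 2 := by
      rw [Real.log_le_iff_le_exp (ENNReal.toReal_pos hM0 hMt)]
      have := ENNReal.toReal_mono ENNReal.ofReal_ne_top hM
      rwa [ENNReal.toReal_ofReal (Real.exp_pos _).le] at this
    have h3 : x₀ * s ≤ y * s := mul_le_mul_of_nonneg_right hy hs0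
    linarith
  have hint := (memLp_lineCramer ν).integrable one_le_two
  calc (1 : ℝ) / 32 = ∫ _ in Set.Ici x₀, (1 / 2 : ℝ) ∂ν := by
        rw [setIntegral_const, hx₀]; norm_num
    _ ≤ ∫ x in Set.Ici x₀, (lineCramer ν x).toReal ∂ν := by
        refine setIntegral_mono_on_ae (integrable_const _).integrableOn hint.integrableOn
          measurableSet_Ici ?_
        filter_upwards [ae_lineCramer_ne_top ν] with x hxt hxm
        have := ENNReal.toReal_mono hxt (hlow x hxm)
        rwa [ENNReal.toReal_ofReal (by norm_num)] at this
    _ ≤ ∫ x, (lineCramer ν x).toReal ∂ν :=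
        setIntegral_le_integral hint (ae_of_all _ fun x => ENNReal.toReal_nonneg)

/-! ### The Cramér transform of a product measure -/

theorem ae_pi_lineCramer_ne_top {n : ℕ} (lam : Fin n → Measure ℝ)
    [∀ i, IsProbabilityMeasure (lam i)] :
    ∀ᵐ x ∂(Measure.pi lam), ∀ i, lineCramer (lam i) (x i) ≠ ⊤ :=
  ae_all_iff.2 fun i =>
    (measurePreserving_eval lam i).quasiMeasurePreserving.ae (ae_lineCramer_ne_top (lam i))

theorem ae_cramerTransform_pi_eq_ofReal {n : ℕ} (lam : Fin n → Measure ℝ)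
    [∀ i, IsProbabilityMeasure (lam i)] :
    ∀ᵐ x ∂(Measure.pi lam), (cramerTransform (Measure.pi lam) x).toENNReal =
      ENNReal.ofReal (∑ i, (lineCramer (lam i) (x i)).toReal) := by
  filter_upwards [ae_pi_lineCramer_ne_top lam] with x hx
  rw [cramerTransform_pi, ENNReal.ofReal_sum_of_nonneg fun i _ => ENNReal.toReal_nonneg]
  exact Finset.sum_congr rfl fun i _ => (ENNReal.ofReal_toReal (hx i)).symm

theorem integrable_lineCramer_eval {n : ℕ} (lam : Fin n → Measure ℝ)
    [∀ i, IsProbabilityMeasure (lam i)] (i : Fin n) :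
    Integrable (fun x : Fin n → ℝ => (lineCramer (lam i) (x i)).toReal) (Measure.pi lam) :=
  (measurePreserving_eval lam i).integrable_comp_of_integrable
    ((memLp_lineCramer (lam i)).integrable one_le_two)

theorem integral_sum_lineCramer {n : ℕ} (lam : Fin n → Measure ℝ)
    [∀ i, IsProbabilityMeasure (lam i)] :
    ∫ x, ∑ i, (lineCramer (lam i) (x i)).toReal ∂(Measure.pi lam) =
      ∑ i, ∫ y, (lineCramer (lam i) y).toReal ∂(lam i) := by
  rw [integral_finsetSum _ fun i _ => integrable_lineCramer_eval lam i]
  refine Finset.sum_congr rfl fun i _ => ?_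
  have h := integral_map (μ := Measure.pi lam) (measurable_pi_apply i).aemeasurable
    (measurable_lineCramer (lam i)).ennreal_toReal.aestronglyMeasurable
  rw [← h]
  exact congrArg (fun ν : Measure ℝ => ∫ y, (lineCramer (lam i) y).toReal ∂ν)
    (measurePreserving_eval lam i).map_eq

theorem lexpCramer_pi {n : ℕ} (lam : Fin n → Measure ℝ) [∀ i, IsProbabilityMeasure (lam i)] :
    lexpCramer (Measure.pi lam) =
      ENNReal.ofReal (∑ i, ∫ y, (lineCramer (lam i) y).toReal ∂(lam i)) := by
  rw [lexpCramer, lintegral_congr_ae (ae_cramerTransform_pi_eq_ofReal lam),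
    ← integral_sum_lineCramer, ofReal_integral_eq_lintegral_ofReal
      (integrable_finsetSum _ fun i _ => integrable_lineCramer_eval lam i)
      (ae_of_all _ fun x => Finset.sum_nonneg fun i _ => ENNReal.toReal_nonneg)]

theorem expCramer_pi {n : ℕ} (lam : Fin n → Measure ℝ) [∀ i, IsProbabilityMeasure (lam i)] :
    expCramer (Measure.pi lam) = ∑ i, ∫ y, (lineCramer (lam i) y).toReal ∂(lam i) := by
  rw [expCramer, lexpCramer_pi, ENNReal.toReal_ofReal]
  exact Finset.sum_nonneg fun i _ => integral_nonneg fun y => ENNReal.toReal_nonneg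

theorem expCramer_pi_le {n : ℕ} (lam : Fin n → Measure ℝ) [∀ i, IsProbabilityMeasure (lam i)] :
    expCramer (Measure.pi lam) ≤ 3 * n := by
  rw [expCramer_pi]
  refine (Finset.sum_le_sum fun i _ => integral_lineCramer_le (lam i)).trans ?_
  simp [mul_comm]

theorem le_expCramer_pi {n : ℕ} (lam : Fin n → Measure ℝ) [∀ i, IsProbabilityMeasure (lam i)]
    (hlam : ∀ i, IsLogConcaveMeasure (lam i)) (h1 : ∀ i x, lam i {x} < 1) :
    (n : ℝ) / 32 ≤ expCramer (Measure.pi lam) := by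
  rw [expCramer_pi]
  refine le_trans ?_ (Finset.sum_le_sum fun i _ => (hlam i).le_integral_lineCramer (h1 i))
  simp [div_eq_mul_inv]

theorem measurableSet_cramer_deviation {n : ℕ} (lam : Fin n → Measure ℝ) (s c : ℝ) :
    MeasurableSet {x : Fin n → ℝ | s ≤ |∑ i, (lineCramer (lam i) (x i)).toReal - c|} := by
  refine measurableSet_le measurable_const ?_
  refine Measurable.abs (Measurable.sub_const (Finset.measurable_sum _ fun i _ => ?_) _)
  exact ((measurable_lineCramer (lam i)).comp (measurable_pi_apply i)).ennreal_toReal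

/-- Chebyshev's inequality for the Cramér transform of a product measure. -/
theorem measure_cramer_deviation_le {n : ℕ} (lam : Fin n → Measure ℝ)
    [∀ i, IsProbabilityMeasure (lam i)] {s : ℝ} (hs : 0 < s) :
    Measure.pi lam {x | s ≤ |∑ i, (lineCramer (lam i) (x i)).toReal - expCramer (Measure.pi lam)|}
      ≤ ENNReal.ofReal (4 * n / s ^ 2) := by
  have hmem : MemLp (∑ i, fun x : Fin n → ℝ => (lineCramer (lam i) (x i)).toReal) 2
      (Measure.pi lam) :=
    memLp_finsetSum' _ fun i _ =>
      (memLp_lineCramer (lam i)).comp_measurePreserving (measurePreserving_eval lam i)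
  have hvar := ProbabilityTheory.variance_sum_pi (μ := lam) fun i => memLp_lineCramer (lam i)
  have hcheb := ProbabilityTheory.meas_ge_le_variance_div_sq hmem hs
  have hE : ∫ x, (∑ i, fun x : Fin n → ℝ => (lineCramer (lam i) (x i)).toReal) x
      ∂(Measure.pi lam) = expCramer (Measure.pi lam) := by
    rw [expCramer_pi, ← integral_sum_lineCramer]
    simp only [Finset.sum_apply]
  rw [hE, hvar] at hcheb
  simp only [Finset.sum_apply] at hcheb
  refine hcheb.trans (ENNReal.ofReal_le_ofReal ?_)
  gcongr
  refine (Finset.sum_le_sum fun i _ => variance_lineCramer_le (lam i)).trans ?_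
  simp [mul_comm]

/-! ### Bounds for the expected measure of the convex hull -/

/-- If every point satisfied ⟨y, ξ⟩ < ⟨x, ξ⟩, so would the whole hull. A union bound over the points
and Chernoff's bound for a ξ witnessing the value of the transform conclude. -/
theorem measure_mem_convexHull_le {n : ℕ} (μ : Measure (Fin n → ℝ)) [IsProbabilityMeasure μ]
    (N : ℕ) {x : Fin n → ℝ} {t : ℝ} (ht : 0 ≤ t)
    (hx : ENNReal.ofReal t < (cramerTransform μ x).toENNReal) :
    (Measure.pi fun _ : Fin N => μ) {X | x ∈ convexHull ℝ (Set.range X)} ≤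
      N * ENNReal.ofReal (Real.exp (-t)) := by
  rw [cramerTransform_toENNReal] at hx
  obtain ⟨ξ, hξ⟩ := lt_iSup_iff.1 hx
  rw [← not_le, subLog_le_ofReal_iff ht, not_le] at hξ
  have hm : Measurable fun y : Fin n → ℝ => y ⬝ᵥ ξ := by
    simp only [dotProduct]; fun_prop
  have hM := measure_le_of_lintegral_exp_lt hm hξ
  have hms : MeasurableSet {y : Fin n → ℝ | x ⬝ᵥ ξ ≤ y ⬝ᵥ ξ} :=
    measurableSet_le measurable_const hm
  have hsub : {X : Fin N → Fin n → ℝ | x ∈ convexHull ℝ (Set.range X)} ⊆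
      ⋃ j, (fun X : Fin N → Fin n → ℝ => X j) ⁻¹' {y | x ⬝ᵥ ξ ≤ y ⬝ᵥ ξ} := by
    intro X hX
    by_contra hcon
    simp only [Set.mem_iUnion, Set.mem_preimage, Set.mem_ofPred_eq, not_exists, not_le] at hcon
    have hconv : Convex ℝ {y : Fin n → ℝ | y ⬝ᵥ ξ < x ⬝ᵥ ξ} :=
      convex_halfSpace_lt ⟨fun a b => add_dotProduct a b ξ, fun c a => smul_dotProduct c a ξ⟩ _
    have hxx : x ⬝ᵥ ξ < x ⬝ᵥ ξ :=
      convexHull_min (by rintro _ ⟨j, rfl⟩; exact hcon j) hconv hX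
    exact lt_irrefl _ hxx
  refine (measure_mono hsub).trans ((measure_iUnion_le _).trans ?_)
  rw [tsum_fintype]
  have hj : ∀ j : Fin N, (Measure.pi fun _ : Fin N => μ)
      ((fun X : Fin N → Fin n → ℝ => X j) ⁻¹' {y | x ⬝ᵥ ξ ≤ y ⬝ᵥ ξ}) ≤
      ENNReal.ofReal (Real.exp (-t)) := by
    intro j
    refine le_trans (le_of_eq ?_) hM
    exact (measurePreserving_eval (fun _ : Fin N => μ) j).measure_preimage hms.nullMeasurableSet
  refine (Finset.sum_le_sum fun j _ => hj j).trans ?_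
  simp

theorem expHullMeasure_le_one {n : ℕ} (μ : Measure (Fin n → ℝ)) [IsProbabilityMeasure μ]
    (N : ℕ) : expHullMeasure μ N ≤ 1 := by
  refine (lintegral_mono fun X => prob_le_one).trans ?_
  simp

theorem expHullMeasure_zero {n : ℕ} (μ : Measure (Fin n → ℝ)) : expHullMeasure μ 0 = 0 := by
  simp [expHullMeasure]

theorem expHullMeasure_pi_le {n : ℕ} (lam : Fin n → Measure ℝ)
    [∀ i, IsProbabilityMeasure (lam i)] (N : ℕ) {s : ℝ} (hs : 0 < s) :
    expHullMeasure (Measure.pi lam) N ≤ ENNReal.ofReal (4 * n / s ^ 2) +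
      ENNReal.ofReal (N * Real.exp (-(expCramer (Measure.pi lam) - s))) := by
  set μ := Measure.pi lam with hμ
  set E := expCramer μ with hE
  rcases Nat.eq_zero_or_pos N with rfl | hN
  · rw [expHullMeasure_zero]; exact zero_le
  rcases lt_or_ge (E - s) 0 with hneg | ht
  · refine (expHullMeasure_le_one μ N).trans (le_add_left ?_)
    rw [ENNReal.one_le_ofReal]
    have h1 : (1 : ℝ) ≤ N := by exact_mod_cast hN
    have h2 : 1 ≤ Real.exp (-(E - s)) := Real.one_le_exp (by linarith)
    nlinarith
  set D : Set (Fin n → ℝ) := {x | s ≤ |∑ i, (lineCramer (lam i) (x i)).toReal - E|} with hD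
  have hDm : MeasurableSet D := measurableSet_cramer_deviation lam s E
  rw [expHullMeasure_eq_lintegral]
  calc _ ≤ ∫⁻ x, D.indicator 1 x + N * ENNReal.ofReal (Real.exp (-(E - s))) ∂μ := by
        refine lintegral_mono_ae ?_
        filter_upwards [ae_cramerTransform_pi_eq_ofReal lam] with x hx
        by_cases hxD : x ∈ D
        · simp only [Set.indicator_of_mem hxD, Pi.one_apply]
          exact prob_le_one.trans le_self_add
        · rw [Set.indicator_of_notMem hxD, zero_add]
          refine measure_mem_convexHull_le μ N ht ?_
          rw [hx]
          have hx' : |∑ i, (lineCramer (lam i) (x i)).toReal - E| < s := not_le.1 hxD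
          have := (abs_lt.1 hx').1
          refine (ENNReal.ofReal_lt_ofReal_iff_of_nonneg ht).2 (by linarith)
    _ = μ D + N * ENNReal.ofReal (Real.exp (-(E - s))) := by
        rw [lintegral_add_right _ measurable_const, lintegral_indicator_one hDm]
        simp
    _ ≤ _ := by
        rw [ENNReal.ofReal_mul N.cast_nonneg, ENNReal.ofReal_natCast]
        gcongr
        exact measure_cramer_deviation_le lam hs

/-- A lower bound for the half-space depth in terms of the Cramér transform. -/
theorem le_measure_halfspace_rpow {n : ℕ} (lam : Fin n → Measure ℝ)
    [∀ i, IsProbabilityMeasure (lam i)] (hlam : ∀ i, IsLogConcaveMeasure (lam i))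
    {x : Fin n → ℝ} {t : ℝ} (ht : 0 ≤ t)
    (hx : (cramerTransform (Measure.pi lam) x).toENNReal ≤ ENNReal.ofReal t) {θ : ℝ}
    (hθ0 : 0 < θ) (hθ1 : θ < 1) (u : Fin n → ℝ) :
    Real.exp (-t) * (1 - θ) ≤ (Measure.pi lam).real {y | y ⬝ᵥ u ≤ x ⬝ᵥ u} ^ θ := by
  set μ := Measure.pi lam with hμ
  -- The direction is reversed so that the half-space becomes {f ≥ 0}; the dual vectors s • (-u)
  -- with s ≥ 0 turn the bound on the transform into the moment hypothesis of the converse Chernoff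
  -- bound.
  set f : (Fin n → ℝ) → ℝ := fun y => y ⬝ᵥ (-u) - x ⬝ᵥ (-u) with hf
  have hfm : Measurable f := by
    simp only [hf, dotProduct]; fun_prop
  have hprob : IsProbabilityMeasure (μ.map f) := Measure.isProbabilityMeasure_map hfm.aemeasurable
  have hIci : ∀ a, (μ.map f).real (Set.Ici a) = μ.real {y | a + x ⬝ᵥ (-u) ≤ y ⬝ᵥ (-u)} := by
    intro a
    rw [map_measureReal_apply hfm measurableSet_Ici]
    congr 1
    ext y
    simp only [hf, Set.mem_preimage, Set.mem_Ici, Set.mem_ofPred_eq]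
    exact le_sub_iff_add_le
  have htail : HasLogConcaveTail (μ.map f) := by
    intro a b τ hτ0 hτ1
    rw [hIci, hIci, hIci]
    have h := logConcave_measure_pi_halfspace lam hlam (-u) hτ0 hτ1 (a + x ⬝ᵥ (-u))
      (b + x ⬝ᵥ (-u))
    have e : (1 - τ) * (a + x ⬝ᵥ (-u)) + τ * (b + x ⬝ᵥ (-u)) =
        (1 - τ) * a + τ * b + x ⬝ᵥ (-u) := by ring
    rwa [e] at h
  have hmom : ∀ s, 0 ≤ s → ENNReal.ofReal (Real.exp (-t)) ≤
      ∫⁻ y, ENNReal.ofReal (Real.exp (s * y)) ∂(μ.map f) := by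
    intro s _
    rw [lintegral_map (by fun_prop) hfm]
    rw [cramerTransform_toENNReal] at hx
    have h := (subLog_le_ofReal_iff ht).1 ((le_iSup _ (s • -u)).trans hx)
    have e : ∫⁻ y, ENNReal.ofReal (Real.exp (s * f y)) ∂μ =
        ENNReal.ofReal (Real.exp (-(x ⬝ᵥ (s • -u)))) *
          ∫⁻ y, ENNReal.ofReal (Real.exp (y ⬝ᵥ (s • -u))) ∂μ := by
      rw [← lintegral_const_mul]
      · refine lintegral_congr fun y => ?_
        rw [← ENNReal.ofReal_mul (Real.exp_pos _).le, ← Real.exp_add]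
        congr 2
        simp only [hf, dotProduct_smul, smul_eq_mul]
        ring
      · simp only [dotProduct]; fun_prop
    rw [e]
    calc ENNReal.ofReal (Real.exp (-t)) = ENNReal.ofReal (Real.exp (-(x ⬝ᵥ (s • -u)))) *
          ENNReal.ofReal (Real.exp (x ⬝ᵥ (s • -u) - t)) := by
          rw [← ENNReal.ofReal_mul (Real.exp_pos _).le, ← Real.exp_add]
          congr 2
          ring
      _ ≤ _ := by gcongr
  have h := htail.reverse_chernoff hθ0 hθ1 hmom
  rw [hIci] at h
  have hset : {y | 0 + x ⬝ᵥ (-u) ≤ y ⬝ᵥ (-u)} = {y : Fin n → ℝ | y ⬝ᵥ u ≤ x ⬝ᵥ u} := by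
    ext y; simp
  rwa [hset] at h

theorem one_le_expHullMeasure_add {n : ℕ} (lam : Fin n → Measure ℝ)
    [∀ i, IsProbabilityMeasure (lam i)] {N : ℕ} (hN : 0 < N)
    {s p : ℝ} (hs : 0 < s) (hp : 0 < p)
    (hdepth : ∀ x, (cramerTransform (Measure.pi lam) x).toENNReal ≤
      ENNReal.ofReal (expCramer (Measure.pi lam) + s) →
      ∀ u, p ≤ (Measure.pi lam).real {y | y ⬝ᵥ u ≤ x ⬝ᵥ u}) :
    1 ≤ expHullMeasure (Measure.pi lam) N + ENNReal.ofReal (4 * n / s ^ 2) +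
      ENNReal.ofReal ((n + 1) / (N * p)) := by
  set μ := Measure.pi lam with hμ
  set E := expCramer μ with hE
  set D : Set (Fin n → ℝ) := {x | s ≤ |∑ i, (lineCramer (lam i) (x i)).toReal - E|} with hD
  have hDm : MeasurableSet D := measurableSet_cramer_deviation lam s E
  set h : (Fin n → ℝ) → ℝ≥0∞ := fun x =>
    (Measure.pi fun _ : Fin N => μ) {X | x ∈ convexHull ℝ (Set.range X)} with hh
  have hNpos : (0 : ℝ) < N := by exact_mod_cast hN
  have hpt : ∀ᵐ x ∂μ, (1 : ℝ≥0∞) ≤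
      h x + (D.indicator 1 x + ENNReal.ofReal ((n + 1) / (N * p))) := by
    filter_upwards [ae_cramerTransform_pi_eq_ofReal lam] with x hx
    by_cases hxD : x ∈ D
    · rw [Set.indicator_of_mem hxD, Pi.one_apply]
      exact le_add_left le_self_add
    · rw [Set.indicator_of_notMem hxD, zero_add]
      have hx' : |∑ i, (lineCramer (lam i) (x i)).toReal - E| < s := not_le.1 hxD
      have hlt := (abs_lt.1 hx').2
      have hd := hdepth x (by rw [hx]; exact ENNReal.ofReal_le_ofReal (by linarith))
      have hmiss := measure_notMem_convexHull_le hN μ x (p := ENNReal.ofReal p) fun u _ => by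
        rw [← ofReal_measureReal]; exact ENNReal.ofReal_le_ofReal (hd u)
      have hcompl : (1 : ℝ≥0∞) ≤ h x + (Measure.pi fun _ : Fin N => μ)
          {X | x ∉ convexHull ℝ (Set.range X)} := by
        have := prob_add_prob_compl (μ := Measure.pi fun _ : Fin N => μ)
          (measurableSet_hull_mem (N := N) x)
        exact this.symm.le
      refine hcompl.trans (add_le_add le_rfl ?_)
      have hNp : (0 : ℝ) < N * p := by positivity
      rw [ENNReal.ofReal_div_of_pos hNp, ENNReal.le_div_iff_mul_le
        (Or.inl (ENNReal.ofReal_pos.2 hNp).ne') (Or.inl ENNReal.ofReal_ne_top)]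
      refine le_trans ?_ (hmiss.trans (le_of_eq ?_))
      · rw [ENNReal.ofReal_mul hNpos.le, ENNReal.ofReal_natCast, mul_comm, mul_assoc]
        gcongr
        simp
      · rw [← ENNReal.ofReal_natCast]; push_cast; rfl
  have hint := lintegral_mono_ae hpt
  have hgm : Measurable fun x => (D.indicator 1 x : ℝ≥0∞) + ENNReal.ofReal ((n + 1) / (N * p)) :=
    (measurable_one.indicator hDm).add measurable_const
  rw [lintegral_add_right _ hgm, lintegral_add_right _ measurable_const, lintegral_indicator_one hDm, ← add_assoc] at hint
  simp only [lintegral_const, measure_univ, mul_one] at hint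
  rw [← expHullMeasure_eq_lintegral] at hint
  refine hint.trans ?_
  gcongr
  exact measure_cramer_deviation_le lam hs

theorem one_le_expHullMeasure_pi_add {n : ℕ} (hn : 1 ≤ n) (lam : Fin n → Measure ℝ)
    [∀ i, IsProbabilityMeasure (lam i)] (hlam : ∀ i, IsLogConcaveMeasure (lam i)) {N : ℕ}
    (hN : 0 < N) {s : ℝ} (hs : 0 < s) :
    1 ≤ expHullMeasure (Measure.pi lam) N + ENNReal.ofReal (4 * n / s ^ 2) +
      ENNReal.ofReal (Real.exp (expCramer (Measure.pi lam) + 2 * s + 7 * √n) / N) := by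
  set E := expCramer (Measure.pi lam) with hE
  have hE0 : 0 ≤ E := ENNReal.toReal_nonneg
  have hE3 : E ≤ 3 * n := expCramer_pi_le lam
  set w := √(n : ℝ) with hw
  have hw2 : w ^ 2 = n := Real.sq_sqrt n.cast_nonneg
  have hw1 : 1 ≤ w := Real.one_le_sqrt.2 (by exact_mod_cast hn)
  have hw0 : 0 < w := by linarith
  set t := E + s with ht
  have ht0 : 0 ≤ t := by positivity
  -- With θ = w / (1 + w), 1/θ = 1 + 1/w and 1 - θ = 1 / (1 + w), so b is the exponent of the depth
  -- bound. The excess is t/w ≤ 3w + s, from E ≤ 3w², plus at most w + 1 ≤ 2w from the logarithm; n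
  -- + 1 ≤ exp(2w) completes 7w.
  set b := (t + Real.log (1 + w)) * (1 + 1 / w) with hb
  have hθ0 : 0 < w / (1 + w) := by positivity
  have hθ1 : w / (1 + w) < 1 := by rw [div_lt_one (by positivity)]; linarith
  have hdepth : ∀ x, (cramerTransform (Measure.pi lam) x).toENNReal ≤ ENNReal.ofReal t →
      ∀ u, Real.exp (-b) ≤ (Measure.pi lam).real {y | y ⬝ᵥ u ≤ x ⬝ᵥ u} := by
    intro x hx u
    have h := le_measure_halfspace_rpow lam hlam ht0 hx hθ0 hθ1 u
    have e : Real.exp (-t) * (1 - w / (1 + w)) = Real.exp (-b) ^ (w / (1 + w)) := by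
      rw [← Real.exp_mul]
      have e1 : 1 - w / (1 + w) = Real.exp (-Real.log (1 + w)) := by
        rw [Real.exp_neg, Real.exp_log (by positivity)]
        field_simp
        ring
      rw [e1, ← Real.exp_add]
      congr 1
      rw [hb]
      field_simp
      ring
    rw [e] at h
    exact (Real.rpow_le_rpow_iff (Real.exp_pos _).le measureReal_nonneg hθ0).1 h
  refine (one_le_expHullMeasure_add lam hN hs (Real.exp_pos (-b)) hdepth).trans ?_
  refine add_le_add le_rfl (ENNReal.ofReal_le_ofReal ?_)
  have hlog : Real.log (1 + w) ≤ w := by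
    have := Real.log_le_sub_one_of_pos (show 0 < 1 + w by positivity)
    linarith
  have hbound : b ≤ E + 2 * s + 5 * w := by
    have h1 : t * (1 / w) ≤ 3 * w + s := by
      rw [mul_one_div, div_le_iff₀ hw0]
      nlinarith
    have h2 : Real.log (1 + w) * (1 + 1 / w) ≤ w * (1 + 1 / w) := by gcongr
    have h3 : w * (1 + 1 / w) = w + 1 := by field_simp
    have : b = t + t * (1 / w) + Real.log (1 + w) * (1 + 1 / w) := by rw [hb]; ring
    linarith
  have hn1 : (n : ℝ) + 1 ≤ Real.exp (2 * w) := by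
    have h1 := Real.add_one_le_exp w
    calc (n : ℝ) + 1 ≤ (w + 1) ^ 2 := by nlinarith
      _ ≤ Real.exp w ^ 2 := by gcongr
      _ = Real.exp (2 * w) := by rw [← Real.exp_nat_mul]; norm_num
  have hNpos : (0 : ℝ) < N := by exact_mod_cast hN
  rw [mul_comm (N : ℝ), ← div_div, Real.exp_neg, div_inv_eq_mul]
  refine div_le_div_of_nonneg_right ?_ hNpos.le
  calc ((n : ℝ) + 1) * Real.exp b ≤ Real.exp (2 * w) * Real.exp (E + 2 * s + 5 * w) := by
        gcongr
    _ = _ := by rw [← Real.exp_add]; congr 1; ring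

/-! ### The threshold window -/

theorem expHullMeasure_pi_one {n : ℕ} (hn : 1 ≤ n) (lam : Fin n → Measure ℝ)
    [∀ i, IsProbabilityMeasure (lam i)] (hlam : ∀ i, IsLogConcaveMeasure (lam i))
    (h1 : ∀ i x, lam i {x} < 1) : expHullMeasure (Measure.pi lam) 1 = 0 := by
  rw [expHullMeasure]
  refine (lintegral_congr fun X => ?_).trans lintegral_zero
  have hrange : Set.range X = {X 0} := Set.range_unique
  have := (hlam ⟨0, hn⟩).nullSingletonClass (h1 _)
  rw [hrange, convexHull_singleton, Measure.pi_singleton]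
  exact Finset.prod_eq_zero (Finset.mem_univ ⟨0, hn⟩) (measure_singleton _)

theorem four_mul_div_sqrt_sq {n : ℕ} (hn : 1 ≤ n) {δ : ℝ} (hδ : 0 < δ) :
    4 * (n : ℝ) / √(8 * n / δ) ^ 2 = δ / 2 := by
  have : (0 : ℝ) < n := by exact_mod_cast hn
  rw [Real.sq_sqrt (by positivity)]
  field_simp
  norm_num

/-- The error δ is shared equally: √(8n/δ) makes the Chebyshev term δ/2, and log(2/δ) makes the miss
term at most δ/2. -/
theorem mem_upperWindowSet {n : ℕ} (hn : 1 ≤ n) (lam : Fin n → Measure ℝ)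
    [∀ i, IsProbabilityMeasure (lam i)] (hlam : ∀ i, IsLogConcaveMeasure (lam i)) {δ : ℝ}
    (hδ0 : 0 < δ) (hδ1 : δ < 1) :
    expCramer (Measure.pi lam) + 2 * √(8 * n / δ) + 7 * √n + Real.log (2 / δ) ∈
      upperWindowSet (Measure.pi lam) δ := by
  have hE0 : 0 ≤ expCramer (Measure.pi lam) := ENNReal.toReal_nonneg
  have hnpos : (0 : ℝ) < n := by exact_mod_cast hn
  have hlog : 0 < Real.log (2 / δ) := Real.log_pos (by rw [lt_div_iff₀ hδ0]; linarith)
  refine ⟨by positivity, fun N hN => ?_⟩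
  have hNpos : (0 : ℝ) < N := (Real.exp_pos _).trans_le hN
  have h := one_le_expHullMeasure_pi_add hn lam hlam (N := N) (by exact_mod_cast hNpos)
    (s := √(8 * n / δ)) (by positivity)
  rw [four_mul_div_sqrt_sq hn hδ0] at h
  have h2 : Real.exp (expCramer (Measure.pi lam) + 2 * √(8 * n / δ) + 7 * √n) / N ≤ δ / 2 := by
    rw [Real.exp_add, Real.exp_log (by positivity)] at hN
    rw [div_le_iff₀ hNpos]
    calc _ = δ / 2 * (Real.exp (expCramer (Measure.pi lam) + 2 * √(8 * n / δ) + 7 * √n) *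
          (2 / δ)) := by field_simp
      _ ≤ _ := by gcongr
  have h3 : (1 : ℝ≥0∞) ≤ expHullMeasure (Measure.pi lam) N + ENNReal.ofReal δ := by
    refine h.trans ?_
    rw [add_assoc, ← ENNReal.ofReal_add (by positivity) (by positivity)]
    gcongr
    linarith
  rw [ENNReal.ofReal_sub _ hδ0.le, ENNReal.ofReal_one]
  exact tsub_le_iff_right.2 h3

theorem mem_lowerWindowSet {n : ℕ} (hn : 1 ≤ n) (lam : Fin n → Measure ℝ)
    [∀ i, IsProbabilityMeasure (lam i)] {δ : ℝ} (hδ0 : 0 < δ)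
    (hpos : 0 < expCramer (Measure.pi lam) - √(8 * n / δ) - Real.log (2 / δ)) :
    expCramer (Measure.pi lam) - √(8 * n / δ) - Real.log (2 / δ) ∈
      lowerWindowSet (Measure.pi lam) δ := by
  have hnpos : (0 : ℝ) < n := by exact_mod_cast hn
  refine ⟨hpos, fun N hN => ?_⟩
  have h := expHullMeasure_pi_le lam N (s := √(8 * n / δ)) (by positivity)
  rw [four_mul_div_sqrt_sq hn hδ0] at h
  have h2 : (N : ℝ) * Real.exp (-(expCramer (Measure.pi lam) - √(8 * n / δ))) ≤ δ / 2 := by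
    rw [Real.exp_sub, Real.exp_log (by positivity)] at hN
    calc _ ≤ Real.exp (expCramer (Measure.pi lam) - √(8 * n / δ)) / (2 / δ) *
          Real.exp (-(expCramer (Measure.pi lam) - √(8 * n / δ))) := by gcongr
      _ = δ / 2 := by rw [Real.exp_neg]; field_simp
  refine h.trans ?_
  rw [← ENNReal.ofReal_add (by positivity) (by positivity)]
  exact ENNReal.ofReal_le_ofReal (by linarith)

theorem lowerWindowSet_nonempty {n : ℕ} (hn : 1 ≤ n) (lam : Fin n → Measure ℝ)
    [∀ i, IsProbabilityMeasure (lam i)] (hlam : ∀ i, IsLogConcaveMeasure (lam i))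
    (h1 : ∀ i x, lam i {x} < 1) (δ : ℝ) : (lowerWindowSet (Measure.pi lam) δ).Nonempty := by
  -- Since exp(1/2) < 2, only N = 0 and N = 1 are tested, and the hull of at most one point is null.
  refine ⟨1 / 2, by norm_num, fun N hN => ?_⟩
  have hexp : Real.exp (1 / 2) < 2 := by
    have h := Real.exp_one_lt_d9
    have h2 : Real.exp (1 / 2) ^ 2 = Real.exp 1 := by rw [← Real.exp_nat_mul]; norm_num
    nlinarith [Real.exp_pos (1 / 2)]
  have hN2 : N < 2 := by exact_mod_cast hN.trans_lt hexp
  interval_cases N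
  · rw [expHullMeasure_zero]; exact zero_le
  · rw [expHullMeasure_pi_one hn lam hlam h1]; exact zero_le

theorem lowerWindowSet_bddAbove {n : ℕ} (hn : 1 ≤ n) (lam : Fin n → Measure ℝ)
    [∀ i, IsProbabilityMeasure (lam i)] (hlam : ∀ i, IsLogConcaveMeasure (lam i)) {δ : ℝ}
    (hδ0 : 0 < δ) (hδ1 : δ < 1) : BddAbove (lowerWindowSet (Measure.pi lam) δ) := by
  -- At level (1 - δ)/2 the expected measure eventually reaches (1 + δ)/2 > δ, which rules out large
  -- members of the lower set.
  obtain ⟨_, hr⟩ := mem_upperWindowSet hn lam hlam (δ := (1 - δ) / 2) (by linarith) (by linarith)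
  set r := expCramer (Measure.pi lam) + 2 * √(8 * n / ((1 - δ) / 2)) + 7 * √n +
    Real.log (2 / ((1 - δ) / 2))
  have hN := hr ⌈Real.exp r⌉₊ (Nat.le_ceil _)
  have hNpos : (0 : ℝ) < ⌈Real.exp r⌉₊ := (Real.exp_pos r).trans_le (Nat.le_ceil _)
  refine ⟨Real.log ⌈Real.exp r⌉₊, fun q hq => ?_⟩
  by_contra hcon
  have h := hN.trans (hq.2 ⌈Real.exp r⌉₊ ((Real.log_le_iff_le_exp hNpos).1 (not_le.1 hcon).le))
  rw [ENNReal.ofReal_le_ofReal_iff hδ0.le] at h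
  linarith

theorem rhoWindow_pi_le {n : ℕ} (hn : 1 ≤ n) (lam : Fin n → Measure ℝ)
    [∀ i, IsProbabilityMeasure (lam i)] (hlam : ∀ i, IsLogConcaveMeasure (lam i))
    (h1 : ∀ i x, lam i {x} < 1) {δ : ℝ} (hδ0 : 0 < δ) (hδ1 : δ < 1) :
    rhoWindow (Measure.pi lam) δ ≤ 22 * √(n / δ) := by
  set E := expCramer (Measure.pi lam) with hE
  have hn1 : (1 : ℝ) ≤ n := by exact_mod_cast hn
  have hup : rhoUpper (Measure.pi lam) δ ≤
      E + 2 * √(8 * n / δ) + 7 * √n + Real.log (2 / δ) :=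
    csInf_le ⟨0, fun q hq => hq.1.le⟩ (mem_upperWindowSet hn lam hlam hδ0 hδ1)
  have hbdd := lowerWindowSet_bddAbove hn lam hlam hδ0 hδ1
  have hlow : E - √(8 * n / δ) - Real.log (2 / δ) ≤ rhoLower (Measure.pi lam) δ := by
    rcases lt_or_ge 0 (E - √(8 * n / δ) - Real.log (2 / δ)) with h | h
    · exact le_csSup hbdd (mem_lowerWindowSet hn lam hδ0 h)
    · obtain ⟨q, hq⟩ := lowerWindowSet_nonempty hn lam hlam h1 δ
      exact h.trans (hq.1.le.trans (le_csSup hbdd hq))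
  set w := √(n / δ) with hw
  have hs : √(8 * n / δ) ≤ 3 * w := by
    rw [Real.sqrt_le_left (by positivity), mul_pow, Real.sq_sqrt (by positivity), mul_div_assoc]
    have : 0 ≤ (n : ℝ) / δ := by positivity
    linarith
  have hsn : √(n : ℝ) ≤ w := by
    apply Real.sqrt_le_sqrt
    rw [le_div_iff₀ hδ0]
    nlinarith
  have hlog : Real.log (2 / δ) ≤ 3 * w := by
    have hd : 0 < √(2 / δ) := by positivity
    have e : Real.log (2 / δ) = 2 * Real.log (√(2 / δ)) := by
      rw [Real.log_sqrt (by positivity)]; ring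
    have h2 := Real.log_le_sub_one_of_pos hd
    have h3 : √(2 / δ) ≤ 3 / 2 * w := by
      rw [Real.sqrt_le_left (by positivity), mul_pow, Real.sq_sqrt (by positivity)]
      rw [← mul_div_assoc]
      gcongr
      linarith
    linarith
  rw [rhoWindow]
  -- In units of √(n/δ): 2·3 + 7 + 3 from above and 3 + 3 from below give 22.
  linarith

theorem rhoWindow_div_expCramer_le {n : ℕ} (hn : 1 ≤ n) (lam : Fin n → Measure ℝ)
    [∀ i, IsProbabilityMeasure (lam i)] (hlam : ∀ i, IsLogConcaveMeasure (lam i))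
    (h1 : ∀ i x, lam i {x} < 1) {δ : ℝ} (hδ0 : 0 < δ) (hδ1 : δ < 1) :
    (expCramer (Measure.pi lam))⁻¹ * rhoWindow (Measure.pi lam) δ ≤
      704 * (δ * n) ^ (-(1 / 2) : ℝ) := by
  have hnpos : (0 : ℝ) < n := by exact_mod_cast hn
  have hE := le_expCramer_pi lam hlam h1
  have hEpos : 0 < expCramer (Measure.pi lam) := lt_of_lt_of_le (by positivity) hE
  have hpow : (δ * n) ^ (-(1 / 2) : ℝ) = √(n / δ) / n := by
    rw [Real.rpow_neg (by positivity), ← Real.sqrt_eq_rpow, Real.sqrt_mul hδ0.le,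
      Real.sqrt_div hnpos.le]
    have : √(n : ℝ) * √(n : ℝ) = n := Real.mul_self_sqrt hnpos.le
    have hsn : 0 < √(n : ℝ) := by positivity
    have hsd : 0 < √δ := by positivity
    field_simp
    linarith
  rw [hpow]
  calc _ ≤ (expCramer (Measure.pi lam))⁻¹ * (22 * √(n / δ)) := by
        gcongr
        exact rhoWindow_pi_le hn lam hlam h1 hδ0 hδ1
    _ ≤ ((n : ℝ) / 32)⁻¹ * (22 * √(n / δ)) := by gcongr
    _ = 704 * (√(n / δ) / n) := by field_simp; norm_num

/-! ### The sharp threshold -/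

theorem tendsto_const_mul_natCast_div_sq {ε : ℝ} (hε : 0 < ε) :
    Tendsto (fun n : ℕ => 4 * (n : ℝ) / (ε * (n / 32)) ^ 2) atTop (𝓝 0) := by
  have h : Tendsto (fun n : ℕ => 4096 / ε ^ 2 * (1 / (n : ℝ))) atTop (𝓝 (4096 / ε ^ 2 * 0)) :=
    tendsto_one_div_atTop_nhds_zero_nat.const_mul _
  rw [mul_zero] at h
  refine h.congr' ?_
  filter_upwards [eventually_ge_atTop 1] with n hn
  have hnpos : (0 : ℝ) < n := by exact_mod_cast hn
  field_simp
  norm_num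

theorem tendsto_exp_sqrt_sub_mul {c : ℝ} (hc : 0 < c) (a : ℝ) :
    Tendsto (fun n : ℕ => Real.exp (a * √n - c * n)) atTop (𝓝 0) := by
  refine Real.tendsto_exp_atBot.comp ?_
  have hsq : Tendsto (fun n : ℕ => √(n : ℝ)) atTop atTop :=
    Real.tendsto_sqrt_atTop.comp tendsto_natCast_atTop_atTop
  have h1 : Tendsto (fun n : ℕ => a - c * √(n : ℝ)) atTop atBot :=
    tendsto_atBot_add_const_left _ a (tendsto_neg_atTop_atBot.comp (hsq.const_mul_atTop hc))
  refine (hsq.atTop_mul_atBot₀ h1).congr fun n => ?_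
  have : √(n : ℝ) * √(n : ℝ) = n := Real.mul_self_sqrt n.cast_nonneg
  linear_combination (-c) * this

theorem tendsto_expHullMeasure_zero (lam : ℕ → Measure ℝ) [∀ m, IsProbabilityMeasure (lam m)]
    (hlam : ∀ m, IsLogConcaveMeasure (lam m)) (h1 : ∀ m x, lam m {x} < 1) {ε : ℝ} (hε : 0 < ε)
    (N : ℕ → ℕ)
    (hN : ∀ᶠ n in atTop, (N n : ℝ) ≤ Real.exp ((1 - ε) * expCramer (prodMeasure lam n))) :
    Tendsto (fun n => expHullMeasure (prodMeasure lam n) (N n)) atTop (𝓝 0) := by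
  have hlim : Tendsto (fun n : ℕ => ENNReal.ofReal (4 * n / (ε / 2 * (n / 32)) ^ 2) +
      ENNReal.ofReal (Real.exp (0 * √n - ε / 64 * n))) atTop (𝓝 0) := by
    have a1 := ENNReal.tendsto_ofReal (tendsto_const_mul_natCast_div_sq (half_pos hε))
    have a2 := ENNReal.tendsto_ofReal (tendsto_exp_sqrt_sub_mul (c := ε / 64) (by positivity) 0)
    simpa using a1.add a2
  refine tendsto_of_tendsto_of_tendsto_of_le_of_le' tendsto_const_nhds hlim
    (Eventually.of_forall fun _ => zero_le) ?_
  filter_upwards [hN, eventually_ge_atTop 1] with n hn hn1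
  have hnpos : (0 : ℝ) < n := by exact_mod_cast hn1
  have hE := le_expCramer_pi (fun i : Fin n => lam i) (fun i => hlam i) (fun i => h1 i)
  change (n : ℝ) / 32 ≤ expCramer (prodMeasure lam n) at hE
  set E := expCramer (prodMeasure lam n) with hEdef
  have hEpos : 0 < E := lt_of_lt_of_le (by positivity) hE
  -- Half of the margin εE is spent on the deviation; the other half gives exp(-εE/2) ≤ exp(-εn/64).
  have h := expHullMeasure_pi_le (fun i : Fin n => lam i) (N n) (s := ε / 2 * E) (by positivity)
  refine h.trans (add_le_add (ENNReal.ofReal_le_ofReal ?_) (ENNReal.ofReal_le_ofReal ?_))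
  · gcongr
  · change (N n : ℝ) * Real.exp (-(E - ε / 2 * E)) ≤ _
    calc _ ≤ Real.exp ((1 - ε) * E) * Real.exp (-(E - ε / 2 * E)) := by gcongr
      _ = Real.exp (-(ε / 2 * E)) := by rw [← Real.exp_add]; congr 1; ring
      _ ≤ _ := by
        apply Real.exp_le_exp.2
        nlinarith

theorem tendsto_expHullMeasure_one (lam : ℕ → Measure ℝ) [∀ m, IsProbabilityMeasure (lam m)]
    (hlam : ∀ m, IsLogConcaveMeasure (lam m)) (h1 : ∀ m x, lam m {x} < 1) {ε : ℝ} (hε : 0 < ε)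
    (N : ℕ → ℕ)
    (hN : ∀ᶠ n in atTop, Real.exp ((1 + ε) * expCramer (prodMeasure lam n)) ≤ (N n : ℝ)) :
    Tendsto (fun n => expHullMeasure (prodMeasure lam n) (N n)) atTop (𝓝 1) := by
  have hlim : Tendsto (fun n : ℕ => 1 - (ENNReal.ofReal (4 * n / (ε / 4 * (n / 32)) ^ 2) +
      ENNReal.ofReal (Real.exp (7 * √n - ε / 64 * n)))) atTop (𝓝 1) := by
    have a1 := ENNReal.tendsto_ofReal (tendsto_const_mul_natCast_div_sq (ε := ε / 4)
      (by positivity))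
    have a2 := ENNReal.tendsto_ofReal (tendsto_exp_sqrt_sub_mul (c := ε / 64) (by positivity) 7)
    have := ENNReal.Tendsto.sub tendsto_const_nhds (a1.add a2) (Or.inl ENNReal.one_ne_top)
    simpa using this
  refine tendsto_of_tendsto_of_tendsto_of_le_of_le' hlim tendsto_const_nhds ?_
    (Eventually.of_forall fun n =>
      expHullMeasure_le_one (Measure.pi fun i : Fin n => lam i) (N n))
  filter_upwards [hN, eventually_ge_atTop 1] with n hn hn1
  have hnpos : (0 : ℝ) < n := by exact_mod_cast hn1
  have hE := le_expCramer_pi (fun i : Fin n => lam i) (fun i => hlam i) (fun i => h1 i)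
  change (n : ℝ) / 32 ≤ expCramer (prodMeasure lam n) at hE
  set E := expCramer (prodMeasure lam n) with hEdef
  have hEpos : 0 < E := lt_of_lt_of_le (by positivity) hE
  have hNpos : (0 : ℝ) < N n := (Real.exp_pos _).trans_le hn
  -- The deviation enters twice in the exponent, so εE/4 uses half of the margin and εE/2 ≥ εn/64
  -- remains to absorb 7√n.
  have h := one_le_expHullMeasure_pi_add hn1 (fun i : Fin n => lam i) (fun i => hlam i)
    (N := N n) (by exact_mod_cast hNpos) (s := ε / 4 * E) (by positivity)
  rw [add_assoc] at h
  refine tsub_le_iff_right.2 (h.trans (add_le_add le_rfl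
    (add_le_add (ENNReal.ofReal_le_ofReal ?_) (ENNReal.ofReal_le_ofReal ?_))))
  · gcongr
  · change Real.exp (E + 2 * (ε / 4 * E) + 7 * √n) / N n ≤ _
    calc _ ≤ Real.exp (E + 2 * (ε / 4 * E) + 7 * √n) / Real.exp ((1 + ε) * E) := by gcongr
      _ = Real.exp (7 * √n - ε / 2 * E) := by rw [← Real.exp_sub]; congr 1; ring
      _ ≤ _ := by
        apply Real.exp_le_exp.2
        nlinarith

theorem theorem2p3 :
    ∃ C : ℝ, 0 < C ∧
      ∀ (lam : ℕ → Measure ℝ), (∀ m, IsProbabilityMeasure (lam m)) →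
        (∀ m, IsLogConcaveMeasure (lam m)) → (∀ m x, lam m {x} < 1) →
        -- the expected Cramér transforms are finite and positive
        (∀ n : ℕ, 1 ≤ n →
          lexpCramer (prodMeasure lam n) ≠ ∞ ∧ 0 < expCramer (prodMeasure lam n)) ∧
        -- the sharp threshold
        (∀ ε : ℝ, 0 < ε → ε < 1 → ∀ N : ℕ → ℕ,
          ((∀ᶠ n in atTop, (N n : ℝ) ≤ Real.exp ((1 - ε) * expCramer (prodMeasure lam n))) →
            Tendsto (fun n => expHullMeasure (prodMeasure lam n) (N n)) atTop (𝓝 0)) ∧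
          ((∀ᶠ n in atTop, Real.exp ((1 + ε) * expCramer (prodMeasure lam n)) ≤ (N n : ℝ)) →
            Tendsto (fun n => expHullMeasure (prodMeasure lam n) (N n)) atTop (𝓝 1))) ∧
        -- the window: its two defining extrema are genuine, and it is small
        (∀ n : ℕ, 1 ≤ n → ∀ δ : ℝ, 0 < δ → δ < 1 →
          (lowerWindowSet (prodMeasure lam n) δ).Nonempty ∧
          BddAbove (lowerWindowSet (prodMeasure lam n) δ) ∧
          (upperWindowSet (prodMeasure lam n) δ).Nonempty ∧
          (expCramer (prodMeasure lam n))⁻¹ * rhoWindow (prodMeasure lam n) δ ≤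
            C * max ((δ * n) ^ (-(1 / 2) : ℝ)) (Real.log n / n)) := by
  refine ⟨704, by norm_num, fun lam hprob hlam h1 => ⟨fun n hn => ⟨?_, ?_⟩, ?_, ?_⟩⟩
  · rw [prodMeasure, lexpCramer_pi]
    exact ENNReal.ofReal_ne_top
  · have hnpos : (0 : ℝ) < n := by exact_mod_cast hn
    exact lt_of_lt_of_le (by positivity)
      (le_expCramer_pi (fun i : Fin n => lam i) (fun i => hlam i) (fun i => h1 i))
  · exact fun ε hε _ N => ⟨tendsto_expHullMeasure_zero lam hlam h1 hε N,
      tendsto_expHullMeasure_one lam hlam h1 hε N⟩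
  · intro n hn δ hδ0 hδ1
    have hlam' : ∀ i : Fin n, IsLogConcaveMeasure (lam i) := fun i => hlam i
    have h1' : ∀ (i : Fin n) x, lam i {x} < 1 := fun i => h1 i
    refine ⟨lowerWindowSet_nonempty hn _ hlam' h1' δ,
      lowerWindowSet_bddAbove hn _ hlam' hδ0 hδ1, ⟨_, mem_upperWindowSet hn _ hlam' hδ0 hδ1⟩, ?_⟩
    refine (rhoWindow_div_expCramer_le hn _ hlam' h1' hδ0 hδ1).trans ?_
    gcongr
    exact le_max_left _ _
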